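/- Let $A$ be a finite-dimensional $C^*$-algebra. A \emph{Riemannian metric} on $A$ is a triple $(\Omega,\partial,\langle\cdot,\cdot\rangle_A)$, where $\Omega$ is an $A$-bimodule, $\partial:A\to\Omega$ is a linear map with $\partial(ab)=(\partial a)b+a\,\partial b$ whose range generates $\Omega$ as a bimodule, and $\langle\cdot,\cdot\rangle_A$ is a positive definite $A$-valued sesquilinear form on $\Omega$ (conjugate linear in the first variable) with $\langle\omega,\omega' a\rangle_A=\langle\omega,\omega'\rangle_A a$, $\langle\omega,\omega'\rangle_A^*=\langle\omega',\omega\rangle_A$ and $\langle a\omega,\omega'\rangle_A=\langle\omega,a^*\omega'\rangle_A$. Put $\Gamma(a,b)=\langle\partial a,\partial b\rangle_A$. The metric is \emph{metrically connected} if $\Gamma(a,a)=0$ only for $a\in\mathbb C1_A$. For a faithful (positive) trace $\tau$ on $A$, the \emph{energy form} is $\mathcal E(a,b)=\tau(\Gamma(a,b))$; it is \emph{real} if $\mathcal E(a^*,b^*)=\mathcal E(b,a)$ for all $a,b$. Its \emph{Laplace operator} is the linear operator $\Delta$ on $A$ with $\mathcal E(a,b)=\tau(a^*\Delta b)$ for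 all $a,b$, and its \emph{energy norm} is $L_{\mathcal E}(a)=\mathcal E(a,a)^{1/2}$. \textbf{Theorem.} Let $\mathcal E$ be the energy form of a metrically connected Riemannian metric on $A$ and a faithful trace $\tau$ on $A$, and assume that $\mathcal E$ is real. Let $\pi:A\to B$ be a surjective $*$-homomorphism onto a nonzero $C^*$-algebra $B$. Then there is a unique central projection $p\in A$ with $\ker\pi=(1-p)A$; identify $B$ with $pA$ through $\pi$, so that $\pi(a)=pa$, and write $$\Delta=\begin{pmatrix}R&J^*\\J&S\end{pmatrix}$$ with respect to $A=pA\oplus(1-p)A$. The operator $S$ is invertible. Put $\Delta^B=R-J^*S^{-1}J$ and $\mathcal E^B(b,b')=\tau(b^*\Delta^B b')$ for $b,b'\in B$. Then the restriction $\tau|_B$ is a faithful trace on $B$, and $\mathcal E^B$ is the energy form of a metrically connected Riemannian metric on $B$ and $\tau|_B$. Moreover $\mathcal E^B$ is real, and the quotient seminorm $L^B(b)=\inf\{L_{\mathcal E}(a):a\in A,\ \pi(a)=b\}$ equals $L_{\mathcal E^B}$ and satisfies the Leibniz inequality $$L^B(bb')\le L^B(b)\,\|b'\|+\|b\|\,L^B(b')\qquad(b,b'\in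 B).$$ -/

import Mathlib

open scoped ComplexOrder

universe u v w

noncomputable section

/-! ### Riemannian metrics on C*-algebras -/

/-- A (right) Riemannian metric on a C*-algebra `A`: an `A`-bimodule `Ω` (the right action of `a` is
`op a • ω`), a derivation `d : A → Ω` whose range generates `Ω` as a bimodule, and a positive
definite `A`-valued sesquilinear form on `Ω`, conjugate linear in the first and right `A`-linear in
the second variable, for which the left action of `A` is a `*`-action. -/
structure RiemannianMetric (A : Type u) [CStarAlgebra A] [PartialOrder A] where
  /-- the bimodule of one-forms -/
  Ω : Type v
  [addCommGroup : AddCommGroup Ω]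
  [complexModule : Module ℂ Ω]
  [leftModule : Module A Ω]
  [rightModule : Module Aᵐᵒᵖ Ω]
  [bimodule : SMulCommClass A Aᵐᵒᵖ Ω]
  [leftTower : IsScalarTower ℂ A Ω]
  [rightTower : IsScalarTower ℂ Aᵐᵒᵖ Ω]
  /-- the derivation -/
  d : A →ₗ[ℂ] Ω
  leibniz : ∀ a b : A, d (a * b) = MulOpposite.op b • d a + a • d b
  generates : ∀ W : Submodule ℂ Ω, (∀ a, d a ∈ W) → (∀ (a : A), ∀ ω ∈ W, a • ω ∈ W) →
    (∀ (a : A), ∀ ω ∈ W, MulOpposite.op a • ω ∈ W) → W = ⊤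
  /-- the `A`-valued inner product -/
  form : Ω →ₗ⋆[ℂ] Ω →ₗ[ℂ] A
  form_right : ∀ (ω η : Ω) (a : A), form ω (MulOpposite.op a • η) = form ω η * a
  form_star : ∀ ω η : Ω, star (form ω η) = form η ω
  form_left : ∀ (a : A) (ω η : Ω), form (a • ω) η = form ω (star a • η)
  form_nonneg : ∀ ω : Ω, 0 ≤ form ω ω
  form_definite : ∀ ω : Ω, form ω ω = 0 → ω = 0

attribute [instance] RiemannianMetric.addCommGroup RiemannianMetric.complexModule
  RiemannianMetric.leftModule RiemannianMetric.rightModule RiemannianMetric.bimodule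
  RiemannianMetric.leftTower RiemannianMetric.rightTower

/-- A faithful (positive, not necessarily normalized) trace on a C*-algebra. -/
structure FaithfulTrace (A : Type u) [CStarAlgebra A] where
  /-- the underlying linear functional -/
  toFun : A →ₗ[ℂ] ℂ
  tracial : ∀ a b : A, toFun (a * b) = toFun (b * a)
  nonneg : ∀ a : A, 0 ≤ toFun (star a * a)
  faithful : ∀ a : A, toFun (star a * a) = 0 → a = 0

namespace RiemannianMetric

variable {A : Type u} [CStarAlgebra A] [PartialOrder A]

/-- The carré-du-champ `Γ(a, b) = ⟨d a, d b⟩` of a Riemannian metric. -/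
def carreDuChamp (M : RiemannianMetric.{u, v} A) : A →ₗ⋆[ℂ] A →ₗ[ℂ] A :=
  LinearMap.mk₂'ₛₗ (starRingEnd ℂ) (RingHom.id ℂ) (fun a b => M.form (M.d a) (M.d b))
    (by simp) (by simp) (by simp) (by simp)

/-- The energy form `E(a, b) = τ(Γ(a, b))` of a Riemannian metric and a faithful trace. -/
def energyForm (M : RiemannianMetric.{u, v} A) (τ : FaithfulTrace A) : A →ₗ⋆[ℂ] A →ₗ[ℂ] ℂ :=
  LinearMap.mk₂'ₛₗ (starRingEnd ℂ) (RingHom.id ℂ) (fun a b => τ.toFun (M.carreDuChamp a b))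
    (by simp) (by simp) (by simp) (by simp)

/-- `A` is metrically connected for `M` if `Γ(a, a) = 0` only for scalar multiples of `1`. -/
def IsMetricallyConnected (M : RiemannianMetric.{u, v} A) : Prop :=
  ∀ a : A, M.carreDuChamp a a = 0 → ∃ z : ℂ, a = z • (1 : A)

end RiemannianMetric

/-! ### Forms, seminorms and the Laplace operator -/

section Forms

variable {A : Type u} [CStarAlgebra A]

/-- A sesquilinear form is real if `E(a*, b*) = E(b, a)`. -/
def IsRealForm (E : A →ₗ⋆[ℂ] A →ₗ[ℂ] ℂ) : Prop :=
  ∀ a b : A, E (star a) (star b) = E b a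

/-- The energy norm `L_E(a) = E(a, a)^{1/2}`. -/
def energyNorm (E : A →ₗ⋆[ℂ] A →ₗ[ℂ] ℂ) (a : A) : ℝ :=
  Real.sqrt (E a a).re

/-- The Leibniz inequality `L(ab) ≤ L(a)‖b‖ + ‖a‖L(b)`. -/
def IsLeibniz (L : A → ℝ) : Prop :=
  ∀ a b : A, L (a * b) ≤ L a * ‖b‖ + ‖a‖ * L b

/-- The quotient `L^B(b) = inf {L(a) : π(a) = b}` of `L` along `π : A → B`. -/
def quotientSeminorm {B : Type w} (π : A → B) (L : A → ℝ) (b : B) : ℝ :=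
  sInf (L '' {a | π a = b})

namespace FaithfulTrace

/-- The map `b ↦ (a ↦ τ(ab))`. -/
def toDual (τ : FaithfulTrace A) : A →ₗ[ℂ] Module.Dual ℂ A :=
  LinearMap.mk₂ ℂ (fun b a => τ.toFun (a * b)) (by simp [mul_add]) (by simp)
    (by simp [add_mul]) (by simp)

theorem toDual_injective (τ : FaithfulTrace A) : Function.Injective τ.toDual := by
  rw [injective_iff_map_eq_zero]
  intro b hb
  exact τ.faithful b (by simpa [toDual] using LinearMap.congr_fun hb (star b))

/-- The linear isomorphism `b ↦ (a ↦ τ(ab))` from `A` onto its dual. -/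
def dualEquiv [FiniteDimensional ℂ A] (τ : FaithfulTrace A) : A ≃ₗ[ℂ] Module.Dual ℂ A :=
  LinearEquiv.ofInjectiveOfFinrankEq τ.toDual τ.toDual_injective Subspace.dual_finrank_eq.symm

/-- The operator `N` on `L²(A, τ)` determined by `E(a, b) = ⟨a, N b⟩_τ = τ(a* N b)`; for the energy
form of a Riemannian metric and `τ` it is the Laplace operator. -/
def laplacian [FiniteDimensional ℂ A] (τ : FaithfulTrace A) (E : A →ₗ⋆[ℂ] A →ₗ[ℂ] ℂ) :
    A →ₗ[ℂ] A :=
  τ.dualEquiv.symm.toLinearMap ∘ₗ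
    LinearMap.mk₂ ℂ (fun b a => E (star a) b) (by simp) (by simp) (by simp) (by simp)

theorem laplacian_spec [FiniteDimensional ℂ A] (τ : FaithfulTrace A)
    (E : A →ₗ⋆[ℂ] A →ₗ[ℂ] ℂ) (a b : A) :
    E a b = τ.toFun (star a * τ.laplacian E b) := by
  have h : τ.dualEquiv (τ.laplacian E b) (star a) = E a b := by
    simp [laplacian]
  exact h.symm

end FaithfulTrace

/-! ### The Schur complement and the quotient form -/

/-- The subspace `pA` of `A`. -/
def corner (p : A) : Submodule ℂ A := LinearMap.range (LinearMap.mulLeft ℂ p)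

/-- The map `a ↦ pa` from `A` onto `pA`. -/
def toCorner (p : A) : A →ₗ[ℂ] corner p := (LinearMap.mulLeft ℂ p).rangeRestrict

/-- The block of `T` from `pA` to `qA`, that is, `x ↦ q T(x)`. -/
def block (T : A →ₗ[ℂ] A) (p q : A) : corner p →ₗ[ℂ] corner q :=
  toCorner q ∘ₗ T ∘ₗ (corner p).subtype

/-- For an operator `T` on `A = pA ⊕ (1-p)A` with block matrix `(R, J'; J, S)`, the Schur complement
`R - J' S⁻¹ J` of `S`, an operator on `pA`. If `T` is self-adjoint on `L²(A, τ)` and `p` is a central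
projection, then `J'` is the adjoint of `J`. (`Ring.inverse S` is the inverse of `S` when `S` is
invertible.) -/
def schurComplement (T : A →ₗ[ℂ] A) (p : A) : corner p →ₗ[ℂ] corner p :=
  block T p p -
    block T (1 - p) p ∘ₗ Ring.inverse (block T (1 - p) (1 - p) : Module.End ℂ (corner (1 - p))) ∘ₗ
      block T p (1 - p)

/-- The quotient `E^B(b, b') = ⟨b, Δ^B b'⟩_τ` on `B = pA` of a form `E` on `A`, where `Δ^B` is the
Schur complement of the operator of `E` on `L²(A, τ)`. -/
def quotientForm [FiniteDimensional ℂ A] (τ : FaithfulTrace A) (E : A →ₗ⋆[ℂ] A →ₗ[ℂ] ℂ) (p : A)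
    (b b' : corner p) : ℂ :=
  τ.toFun (star (b : A) * (schurComplement (τ.laplacian E) p b' : A))

/-- `p` is a central projection of `A` and the kernel of `π : A → B` is `(1-p)A`; for surjective `π`
this means that `π` identifies `pA` with `B`, and `a ↦ pa` with `π`. -/
def IsQuotientProjection {B : Type w} [CStarAlgebra B] (π : A →⋆ₐ[ℂ] B) (p : A) : Prop :=
  IsStarProjection p ∧ (∀ a : A, p * a = a * p) ∧ ∀ a : A, π a = 0 ↔ p * a = 0

end Forms

end

open scoped ComplexOrder

noncomputable section

/-! ### Decompositions into squares and orthogonality in a C*-algebra. -/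

section Positivity

variable {A : Type u} [CStarAlgebra A]

/-! The metric on `B` is not built from the one-forms of `A`. Instead, real energy forms are
characterised by a property of the form alone, `IsCompletelyDirichlet`, and this property is shown
to pass to the quotient.

Real energy forms have the property: for `∑ xᵢ yᵢ = 0`, the number `-∑ E(yᵢ yⱼ*, xᵢ* xⱼ)` is the sum
of the squared lengths of `∑ (d xᵢ) yᵢ` and `∑ yᵢ* d(xᵢ*)` (`isCompletelyDirichlet_energyForm`).
Conversely, in finite dimension with a faithful trace, a form with the property is an energy form:
the functional `c ⊗ z ↦ -E(z*, c)/2` is positive on squares of universal one-forms, and a GNS-type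
quotient gives the metric (`riemannianMetric`, `energyForm_riemannianMetric`).

For the quotient, metric connectedness and `B ≠ 0` make `E` definite on `ker π`, so `S` is
invertible and each `b` has a unique lift `h b` that is `E`-orthogonal to `ker π`, namely `x - S⁻¹ J
x`. The Schur complement form is `E(h b, h b')`. The heart is the maximum principle
`exists_eq_star_mul_self_of_harmonic`, by which `h` is completely positive. Factoring the matrix
`h(xᵢ* xⱼ)` as `Z* Z` turns a relation `∑ xᵢ yᵢ = 0` in `B` into relations `∑ Z k i * y'ᵢ = 0` in
`A`, one for each row, to which the negativity of `E` applies
(`isCompletelyDirichlet_pullbackForm`).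

Since `h b` minimises the energy among lifts of `b`, the quotient seminorm is the energy norm of the
new form, and energy norms of Riemannian metrics are Leibniz. -/

theorem exists_star_mul_self_sub_star_mul_self {a : A} (ha : IsSelfAdjoint a) :
    ∃ u v : A, a = star u * u - star v * v ∧ (star u * u) * (star v * v) = 0 := by
  -- The order is local to the proof, so that the statement also applies to matrices over `A`, for
  -- which no order is fixed.
  let _ := CStarAlgebra.spectralOrder A
  let _ := CStarAlgebra.spectralOrderedRing A
  obtain ⟨u, hu⟩ := CStarAlgebra.nonneg_iff_eq_star_mul_self.mp (CFC.posPart_nonneg a)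
  obtain ⟨v, hv⟩ := CStarAlgebra.nonneg_iff_eq_star_mul_self.mp (CFC.negPart_nonneg a)
  exact ⟨u, v, by rw [← hu, ← hv, CFC.posPart_sub_negPart a ha],
    by rw [← hu, ← hv, CFC.posPart_mul_negPart]⟩

theorem exists_star_mul_self_add_star_mul_self (a b : A) :
    ∃ c : A, star a * a + star b * b = star c * c := by
  let _ := CStarAlgebra.spectralOrder A
  let _ := CStarAlgebra.spectralOrderedRing A
  exact CStarAlgebra.nonneg_iff_eq_star_mul_self.mp
    (add_nonneg (star_mul_self_nonneg a) (star_mul_self_nonneg b))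

theorem eq_zero_of_sum_star_mul_self_eq_zero {ι : Type*} [Fintype ι] {v : ι → A}
    (h : ∑ k, star (v k) * v k = 0) (k : ι) : v k = 0 := by
  let _ := CStarAlgebra.spectralOrder A
  let _ := CStarAlgebra.spectralOrderedRing A
  have := (Finset.sum_eq_zero_iff_of_nonneg fun k _ => star_mul_self_nonneg (v k)).mp h k
    (Finset.mem_univ k)
  exact CStarRing.star_mul_self_eq_zero_iff _ |>.mp this

/-- Two uses of the C*-identity cancel the outer factors. This turns orthogonality of positive
matrices into the relation `X * Y = 0` that conditional negativity needs. -/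
theorem mul_eq_zero_of_star_mul_self_mul {x y : A} (h : (star x * x) * (y * star y) = 0) :
    x * y = 0 := by
  have h1 : (x * y) * star y = 0 := by
    rw [← CStarRing.star_mul_self_eq_zero_iff]
    calc star ((x * y) * star y) * ((x * y) * star y)
        = y * star y * ((star x * x) * (y * star y)) := by simp [mul_assoc]
      _ = 0 := by rw [h, mul_zero]
  rw [← CStarRing.mul_star_self_eq_zero_iff, star_mul, ← mul_assoc, h1, zero_mul]

end Positivity

/-! ### Conditional complete negativity and the maximum principle. -/

section Forms

variable {A : Type u} [CStarAlgebra A]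

/-- A sesquilinear form is conditionally completely negative if
`∑ E(yᵢ yⱼ*, xᵢ* xⱼ) ≤ 0` whenever `∑ xᵢ yᵢ = 0`. -/
def IsConditionallyCompletelyNegative (E : A →ₗ⋆[ℂ] A →ₗ[ℂ] ℂ) : Prop :=
  ∀ (n : ℕ) (x y : Fin n → A), ∑ i, x i * y i = 0 →
    (∑ i, ∑ j, E (y i * star (y j)) (star (x i) * x j)).re ≤ 0

/-- Real completely Dirichlet forms, described by the conditional complete negativity of their
operators. -/
structure IsCompletelyDirichlet (E : A →ₗ⋆[ℂ] A →ₗ[ℂ] ℂ) : Prop where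
  star_apply : ∀ a b, star (E a b) = E b a
  nonneg : ∀ a, 0 ≤ E a a
  apply_one : ∀ a, E a 1 = 0
  real : IsRealForm E
  condNeg : IsConditionallyCompletelyNegative E

/-- The entrywise sum of a form over pairs of matrices. -/
def matrixForm (E : A →ₗ⋆[ℂ] A →ₗ[ℂ] ℂ) {n : ℕ} (W G : CStarMatrix (Fin n) (Fin n) A) : ℂ :=
  ∑ i, ∑ j, E (W i j) (G i j)

/-- The sum splits over pairs of a row of `X` and a column of `Y`; each pair satisfies the scalar
relation because the corresponding entry of `X * Y` vanishes. -/
theorem IsConditionallyCompletelyNegative.matrixForm_re_nonpos {E : A →ₗ⋆[ℂ] A →ₗ[ℂ] ℂ}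
    (hE : IsConditionallyCompletelyNegative E) {n : ℕ} {X Y : CStarMatrix (Fin n) (Fin n) A}
    (h : X * Y = 0) : (matrixForm E (Y * star Y) (star X * X)).re ≤ 0 := by
  have key : matrixForm E (Y * star Y) (star X * X) =
      ∑ k, ∑ l, ∑ i, ∑ j, E (Y i l * star (Y j l)) (star (X k i) * X k j) := by
    simp only [matrixForm, CStarMatrix.mul_apply, CStarMatrix.star_apply, map_sum,
      LinearMap.sum_apply]
    calc _ = ∑ i, ∑ k, ∑ j, ∑ l, E (Y i l * star (Y j l)) (star (X k i) * X k j) :=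
          Finset.sum_congr rfl fun i _ => Finset.sum_comm
      _ = ∑ k, ∑ i, ∑ l, ∑ j, E (Y i l * star (Y j l)) (star (X k i) * X k j) := by
          rw [Finset.sum_comm]
          exact Finset.sum_congr rfl fun k _ => Finset.sum_congr rfl fun i _ => Finset.sum_comm
      _ = _ := Finset.sum_congr rfl fun k _ => Finset.sum_comm
  rw [key, Complex.re_sum]
  refine Finset.sum_nonpos fun k _ => ?_
  rw [Complex.re_sum]
  refine Finset.sum_nonpos fun l _ => hE n (fun i => X k i) (fun i => Y i l) ?_
  rw [← CStarMatrix.mul_apply, h, CStarMatrix.zero_apply]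

theorem matrixForm_add_right (E : A →ₗ⋆[ℂ] A →ₗ[ℂ] ℂ) {n : ℕ}
    (W G H : CStarMatrix (Fin n) (Fin n) A) :
    matrixForm E W (G + H) = matrixForm E W G + matrixForm E W H := by
  simp [matrixForm, Finset.sum_add_distrib]

/-- The scalar matrix of an element of the algebra. -/
def scalarMatrix (n : ℕ) (q : A) : CStarMatrix (Fin n) (Fin n) A :=
  CStarMatrix.ofMatrix (Matrix.diagonal fun _ => q)

theorem scalarMatrix_mul_apply {n : ℕ} (q : A) (M : CStarMatrix (Fin n) (Fin n) A) (i j : Fin n) :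
    (scalarMatrix n q * M) i j = q * M i j :=
  Matrix.diagonal_mul _ _ _ _

theorem mul_scalarMatrix_apply {n : ℕ} (q : A) (M : CStarMatrix (Fin n) (Fin n) A) (i j : Fin n) :
    (M * scalarMatrix n q) i j = M i j * q :=
  Matrix.mul_diagonal _ _ _ _

theorem star_scalarMatrix {n : ℕ} {q : A} (hq : star q = q) :
    star (scalarMatrix n q) = scalarMatrix n q := by
  change Matrix.conjTranspose (Matrix.diagonal fun _ => q) = Matrix.diagonal fun _ => q
  rw [Matrix.diagonal_conjTranspose]
  congr 1
  ext i
  exact hq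

/-- The maximum principle: a self-adjoint matrix of elements that are harmonic off the central
projection `p` and whose cut-down by `p` is positive is positive. -/
theorem IsCompletelyDirichlet.exists_eq_star_mul_self_of_harmonic {E : A →ₗ⋆[ℂ] A →ₗ[ℂ] ℂ}
    (hE : IsCompletelyDirichlet E) {p : A} (hp : IsStarProjection p)
    (hcen : ∀ a : A, p * a = a * p) (hdef : ∀ c : A, p * c = 0 → E c c = 0 → c = 0)
    {n : ℕ} {H X : CStarMatrix (Fin n) (Fin n) A} (hH : IsSelfAdjoint H)
    (hX : ∀ i j, p * H i j = (star X * X) i j)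
    (hharm : ∀ i j c, p * c = 0 → E c (H i j) = 0) :
    ∃ Z : CStarMatrix (Fin n) (Fin n) A, H = star Z * Z := by
  let _ := CStarAlgebra.spectralOrder A
  let _ := CStarAlgebra.spectralOrderedRing A
  obtain ⟨u, v, huv, hzero⟩ :=
    exists_star_mul_self_sub_star_mul_self (A := CStarMatrix (Fin n) (Fin n) A) hH
  have hpp : p * p = p := hp.isIdempotentElem
  set Q := scalarMatrix n (1 - p) with hQ
  have hQcen : ∀ M : CStarMatrix (Fin n) (Fin n) A, Q * M = M * Q := fun M => by
    ext i j
    rw [scalarMatrix_mul_apply, mul_scalarMatrix_apply, sub_mul, mul_sub, hcen, one_mul, mul_one]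
  have hQstar : star Q = Q := star_scalarMatrix (by simp [hp.isSelfAdjoint.star_eq])
  have hQQ : Q * Q = Q := by
    ext i j
    rw [scalarMatrix_mul_apply]
    change (1 - p) * Matrix.diagonal (fun _ => 1 - p) i j = Matrix.diagonal (fun _ => 1 - p) i j
    rw [Matrix.diagonal_apply]
    split_ifs
    · exact hp.one_sub.isIdempotentElem
    · exact mul_zero _
  have hPH : H - Q * H = star X * X := by
    ext i j
    rw [← hX, CStarMatrix.sub_apply, scalarMatrix_mul_apply, sub_mul, one_mul, sub_sub_cancel]
  -- `star Z * Z` is `H` with its negative part off `p` removed: under `p` it is `star X * X`, and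
  -- off `p` it is the positive part `star u * u`. The removed part is `W` below.
  obtain ⟨Z, hZ⟩ := exists_star_mul_self_add_star_mul_self X (u * Q)
  have hu : star (u * Q) * (u * Q) = Q * (star u * u) := by
    rw [star_mul, hQstar, mul_assoc, ← mul_assoc (star u), ← hQcen, ← mul_assoc, hQQ]
  have hv : star (v * Q) * (v * Q) = Q * (star v * v) := by
    rw [star_mul, hQstar, mul_assoc, ← mul_assoc (star v), ← hQcen, ← mul_assoc, hQQ]
  set W := Q * (star v * v) with hW
  have hGW : star Z * Z = H + W := by
    rw [← hZ, hu, ← hPH, hW]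
    nth_rewrite 2 [huv]
    rw [mul_sub]
    abel
  have hprod : (star Z * Z) * (star (v * Q) * star (star (v * Q))) = 0 := by
    rw [star_star, hv, ← hZ, hu, ← hPH, add_mul, hW]
    have h1 : (H - Q * H) * (Q * (star v * v)) = 0 := by
      rw [← mul_assoc (H - Q * H), ← hQcen, mul_sub, ← mul_assoc Q Q, hQQ, sub_self, zero_mul]
    have h2 : Q * (star u * u) * (Q * (star v * v)) = 0 := by
      rw [hQcen (star u * u), mul_assoc, ← mul_assoc Q Q, hQQ, hQcen, ← mul_assoc, hzero,
        zero_mul]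
    rw [h1, h2, add_zero]
  have hneg := hE.condNeg.matrixForm_re_nonpos (mul_eq_zero_of_star_mul_self_mul hprod)
  have hpW : ∀ i j, p * W i j = 0 := fun i j => by
    rw [hW, scalarMatrix_mul_apply, ← mul_assoc, mul_sub, mul_one, hpp, sub_self, zero_mul]
  rw [star_star, hv, hGW, matrixForm_add_right] at hneg
  -- The entries of `W` are killed by `p`, so harmonicity removes `E(W, H)` from `E(W, H + W) ≤ 0`.
  -- Then `E(W, W) ≤ 0` and definiteness off `p` gives `W = 0`.
  have hWH : matrixForm E W H = 0 :=
    Finset.sum_eq_zero fun i _ => Finset.sum_eq_zero fun j _ => hharm i j _ (hpW i j)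
  rw [hWH, zero_add, matrixForm] at hneg
  have hsum : ∑ i, ∑ j, E (W i j) (W i j) = 0 := by
    have h0 : 0 ≤ ∑ i, ∑ j, E (W i j) (W i j) :=
      Finset.sum_nonneg fun i _ => Finset.sum_nonneg fun j _ => hE.nonneg _
    obtain ⟨hre, him⟩ := Complex.le_def.mp h0
    exact Complex.ext (le_antisymm hneg hre) him.symm
  have hW0 : W = 0 := by
    ext i j
    refine hdef _ (hpW i j) ?_
    have h1 := (Finset.sum_eq_zero_iff_of_nonneg fun i _ =>
      Finset.sum_nonneg fun j _ => hE.nonneg (W i j)).mp hsum i (Finset.mem_univ i)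
    exact (Finset.sum_eq_zero_iff_of_nonneg fun j _ => hE.nonneg (W i j)).mp h1 j
      (Finset.mem_univ j)
  exact ⟨Z, by rw [hGW, hW0, add_zero]⟩

end Forms

/-! ### Quotients of completely Dirichlet forms -/

section Quotient

variable {A : Type u} [CStarAlgebra A] {B : Type w} [CStarAlgebra B]

/-- The form `(b, b') ↦ E(h b, h b')`. -/
def pullbackForm (E : A →ₗ⋆[ℂ] A →ₗ[ℂ] ℂ) (h : B →ₗ[ℂ] A) : B →ₗ⋆[ℂ] B →ₗ[ℂ] ℂ :=
  LinearMap.mk₂'ₛₗ (starRingEnd ℂ) (RingHom.id ℂ) (fun b b' => E (h b) (h b'))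
    (by simp) (by simp) (by simp) (by simp)

@[simp]
theorem pullbackForm_apply (E : A →ₗ⋆[ℂ] A →ₗ[ℂ] ℂ) (h : B →ₗ[ℂ] A) (b b' : B) :
    pullbackForm E h b b' = E (h b) (h b') := rfl

/-- A linear section of `π` with values in the elements that are `E`-orthogonal to `ker π`. -/
structure IsHarmonicLift (E : A →ₗ⋆[ℂ] A →ₗ[ℂ] ℂ) (π : A →⋆ₐ[ℂ] B) (h : B →ₗ[ℂ] A) : Prop where
  map_apply : ∀ b, π (h b) = b
  orthogonal : ∀ c b, π c = 0 → E c (h b) = 0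

variable {E : A →ₗ⋆[ℂ] A →ₗ[ℂ] ℂ} {π : A →⋆ₐ[ℂ] B} {h : B →ₗ[ℂ] A}

/-- The difference of two harmonic lifts lies in `ker π` and is orthogonal to itself. -/
theorem IsHarmonicLift.eq_of_orthogonal (hh : IsHarmonicLift E π h)
    (hdef : ∀ c : A, π c = 0 → E c c = 0 → c = 0) {a : A} {b : B} (ha : π a = b)
    (horth : ∀ c, π c = 0 → E c a = 0) : h b = a := by
  have h0 : π (h b - a) = 0 := by rw [map_sub, hh.map_apply, ha, sub_self]
  refine sub_eq_zero.mp (hdef _ h0 ?_)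
  rw [map_sub (E _), hh.orthogonal _ _ h0, horth _ h0, sub_zero]

theorem IsHarmonicLift.map_star (hh : IsHarmonicLift E π h) (hE : IsCompletelyDirichlet E)
    (hdef : ∀ c : A, π c = 0 → E c c = 0 → c = 0) (b : B) : h (star b) = star (h b) := by
  refine hh.eq_of_orthogonal hdef (by rw [StarHomClass.map_star, hh.map_apply]) fun c hc => ?_
  rw [← hE.star_apply, ← star_star c, hE.real, star_eq_zero]
  exact hh.orthogonal _ _ (by rw [StarHomClass.map_star, hc, star_zero])

theorem IsHarmonicLift.map_one (hh : IsHarmonicLift E π h) (hE : IsCompletelyDirichlet E)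
    (hdef : ∀ c : A, π c = 0 → E c c = 0 → c = 0) : h 1 = 1 :=
  hh.eq_of_orthogonal hdef (_root_.map_one π) fun c _ => hE.apply_one c

/-- Only one argument has to be harmonic. As `h` is not multiplicative, this freedom is what allows
a product of lifts in the other argument. -/
theorem IsHarmonicLift.apply_eq (hh : IsHarmonicLift E π h) (a : A) (b b' : B) (ha : π a = b) :
    E (h b) (h b') = E a (h b') := by
  have : E (h b - a) (h b') = 0 :=
    hh.orthogonal _ _ (by rw [map_sub, hh.map_apply, ha, sub_self])
  rwa [map_sub, LinearMap.sub_apply, sub_eq_zero] at this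

/-- Complete positivity of `h`, from the maximum principle, reduces conditional negativity on `B` to
that on `A`; the other properties follow from `h 1 = 1` and `h(b*) = h(b)*`. -/
theorem IsHarmonicLift.isCompletelyDirichlet_pullbackForm (hh : IsHarmonicLift E π h)
    (hE : IsCompletelyDirichlet E) (hdef : ∀ c : A, π c = 0 → E c c = 0 → c = 0)
    {p : A} (hp : IsQuotientProjection π p) : IsCompletelyDirichlet (pullbackForm E h) where
  star_apply a b := hE.star_apply _ _
  nonneg a := hE.nonneg _
  apply_one a := by rw [pullbackForm_apply, hh.map_one hE hdef, hE.apply_one]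
  real a b := by
    rw [pullbackForm_apply, hh.map_star hE hdef, hh.map_star hE hdef, hE.real, pullbackForm_apply]
  condNeg := by
    intro n x y hxy
    obtain ⟨hproj, hcen, hker⟩ := hp
    have hpp : p * p = p := hproj.isIdempotentElem
    have hps : star p = p := hproj.isSelfAdjoint.star_eq
    have hcut : ∀ {a a' : A}, π a = π a' → p * a = p * a' := fun {a a'} haa => by
      rw [← sub_eq_zero, ← mul_sub, ← hker, map_sub, haa, sub_self]
    have hπp : π p = 1 := by
      have : π (1 - p) = 0 := (hker _).mpr (by rw [mul_sub, mul_one, hpp, sub_self])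
      rw [map_sub, _root_.map_one, sub_eq_zero] at this
      exact this.symm
    -- The matrix `X` below needs a row with index `0`, so the empty family is treated apart.
    rcases n with _ | n
    · simp
    -- Lifts inside `pA`, where `π` is injective, so that `∑ xᵢ yᵢ = 0` lifts to an exact relation.
    obtain ⟨x', hx'⟩ : ∃ x' : Fin (n + 1) → A, x' = fun i => p * h (x i) := ⟨_, rfl⟩
    obtain ⟨y', hy'⟩ : ∃ y' : Fin (n + 1) → A, y' = fun i => p * h (y i) := ⟨_, rfl⟩
    have hπx : ∀ i, π (x' i) = x i := fun i => by simp [hx', hπp, hh.map_apply]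
    have hπy : ∀ i, π (y' i) = y i := fun i => by simp [hy', hπp, hh.map_apply]
    have hpx : ∀ i, p * x' i = x' i := fun i => by simp only [hx', ← mul_assoc, hpp]
    have hpy : ∀ i, p * y' i = y' i := fun i => by simp only [hy', ← mul_assoc, hpp]
    have hxy' : ∑ i, x' i * y' i = 0 := by
      have h1 : ∑ i, x' i * y' i = p * ∑ i, x' i * y' i := by
        rw [Finset.mul_sum]
        exact Finset.sum_congr rfl fun i _ => by rw [← mul_assoc, hpx]
      rw [h1, ← hker, map_sum, ← hxy]
      exact Finset.sum_congr rfl fun i _ => by rw [map_mul, hπx, hπy]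
    set H : CStarMatrix (Fin (n + 1)) (Fin (n + 1)) A :=
      CStarMatrix.ofMatrix (Matrix.of fun i j => h (star (x i) * x j)) with hH
    have hHapply : ∀ i j, H i j = h (star (x i) * x j) := fun i j => rfl
    have hpH : ∀ i j, p * H i j = star (x' i) * x' j := fun i j => by
      have : star (x' i) * x' j = p * (star (x' i) * x' j) := by
        rw [← mul_assoc]
        congr 1
        rw [hcen, ← hps, ← star_mul, hpx]
      rw [this]
      refine hcut ?_
      rw [hHapply, hh.map_apply, map_mul, StarHomClass.map_star, hπx, hπx]
    -- The only nonzero row is `x'`, which makes `star X * X` the matrix of the `x'ᵢ* x'ⱼ`.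
    set X : CStarMatrix (Fin (n + 1)) (Fin (n + 1)) A :=
      CStarMatrix.ofMatrix (Matrix.of fun k i => if k = 0 then x' i else 0) with hX
    obtain ⟨Z, hZ⟩ := hE.exists_eq_star_mul_self_of_harmonic hproj hcen
      (fun c hc => hdef c ((hker c).mpr hc)) (H := H) (X := X)
      (by
        rw [IsSelfAdjoint]
        ext i j
        rw [CStarMatrix.star_apply, hHapply, hHapply, ← hh.map_star hE hdef, star_mul, star_star])
      (fun i j => by
        rw [hpH, CStarMatrix.mul_apply, Finset.sum_eq_single 0]
        · simp [hX, CStarMatrix.star_apply]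
        · intro k _ hk
          simp [hX, hk]
        · simp)
      (fun i j c hc => hh.orthogonal _ _ ((hker c).mpr hc))
    have hHsum : ∀ i j, h (star (x i) * x j) = ∑ k, star (Z k i) * Z k j := fun i j => by
      rw [← hHapply, hZ, CStarMatrix.mul_apply]
      rfl
    -- The squares of these sums add up to `∑ y'ᵢ* H i j y'ⱼ`. The `y'ⱼ` see only the cut-down of
    -- `H` by `p`, so this is the square of `∑ x'ᵢ y'ᵢ = 0`.
    have hZy : ∀ k, ∑ i, Z k i * y' i = 0 := by
      refine eq_zero_of_sum_star_mul_self_eq_zero ?_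
      calc ∑ k, star (∑ i, Z k i * y' i) * ∑ i, Z k i * y' i
          = ∑ k, ∑ i, ∑ j, star (y' i) * (star (Z k i) * Z k j) * y' j := by
            simp only [star_sum, star_mul, Finset.sum_mul_sum, mul_assoc]
        _ = ∑ i, ∑ j, star (y' i) * H i j * y' j := by
            rw [Finset.sum_comm]
            refine Finset.sum_congr rfl fun i _ => ?_
            rw [Finset.sum_comm]
            refine Finset.sum_congr rfl fun j _ => ?_
            rw [hHapply, hHsum, Finset.mul_sum, Finset.sum_mul]
        _ = ∑ i, ∑ j, star (x' i * y' i) * (x' j * y' j) := by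
            refine Finset.sum_congr rfl fun i _ => Finset.sum_congr rfl fun j _ => ?_
            have h1 : H i j * y' j = star (x' i) * x' j * y' j := by
              rw [← hpH, hcen, mul_assoc, hpy]
            rw [mul_assoc, h1, star_mul]
            simp only [mul_assoc]
        _ = star (∑ i, x' i * y' i) * ∑ i, x' i * y' i := by
            rw [star_sum, Finset.sum_mul_sum]
        _ = 0 := by rw [hxy', mul_zero]
    have key : ∑ i, ∑ j, pullbackForm E h (y i * star (y j)) (star (x i) * x j) =
        ∑ k, ∑ i, ∑ j, E (y' i * star (y' j)) (star (Z k i) * Z k j) := by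
      rw [Finset.sum_comm (γ := Fin (n + 1)) (s := Finset.univ) (t := Finset.univ)
        (f := fun k i => ∑ j, E (y' i * star (y' j)) (star (Z k i) * Z k j))]
      refine Finset.sum_congr rfl fun i _ => ?_
      rw [Finset.sum_comm]
      refine Finset.sum_congr rfl fun j _ => ?_
      rw [pullbackForm_apply, hh.apply_eq (y' i * star (y' j)) _ _
        (by rw [map_mul, StarHomClass.map_star, hπy, hπy]), hHsum, map_sum]
    rw [key, Complex.re_sum]
    exact Finset.sum_nonpos fun k _ => hE.condNeg _ _ _ (hZy k)

end Quotient

/-! ### Energy forms of Riemannian metrics -/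

namespace FaithfulTrace

variable {A : Type u} [CStarAlgebra A] (τ : FaithfulTrace A)

/-- Polarisation: `τ(x* x)` is real for `x = 1, a, 1 + a, 1 + i a`. -/
theorem map_star (a : A) : τ.toFun (star a) = star (τ.toFun a) := by
  have him : ∀ x : A, (τ.toFun (star x * x)).im = 0 := fun x =>
    (Complex.le_def.mp (τ.nonneg x)).2.symm
  have h0 := him a
  have h1 := him 1
  have h2 := him (1 + a)
  have h3 := him (1 + Complex.I • a)
  simp only [star_add, star_one, mul_add, add_mul, mul_one, one_mul, star_smul, map_add, map_smul,
    smul_mul_assoc, mul_smul_comm, Complex.add_im, smul_eq_mul, RCLike.star_def,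
    Complex.conj_I, neg_mul, Complex.mul_im, Complex.I_re, Complex.I_im,
    Complex.neg_im, Complex.neg_re, zero_mul] at h0 h1 h2 h3
  apply Complex.ext <;> simp at h0 h1 h2 h3 ⊢ <;> linarith

theorem eq_zero_of_nonneg [PartialOrder A] [StarOrderedRing A] {a : A} (ha : 0 ≤ a)
    (h : τ.toFun a = 0) : a = 0 := by
  obtain ⟨s, rfl⟩ := CStarAlgebra.nonneg_iff_eq_star_mul_self.mp ha
  rw [τ.faithful s h, mul_zero]

theorem apply_nonneg [PartialOrder A] [StarOrderedRing A] {a : A} (ha : 0 ≤ a) :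
    0 ≤ τ.toFun a := by
  obtain ⟨s, rfl⟩ := CStarAlgebra.nonneg_iff_eq_star_mul_self.mp ha
  exact τ.nonneg s

theorem re_apply_mono [PartialOrder A] [StarOrderedRing A] {a b : A} (h : a ≤ b) :
    (τ.toFun a).re ≤ (τ.toFun b).re := by
  have := (Complex.le_def.mp (τ.apply_nonneg (sub_nonneg.mpr h))).1
  rw [map_sub, Complex.sub_re, Complex.zero_re] at this
  linarith

theorem ext_mul_left {a b : A} (h : ∀ c, τ.toFun (c * a) = τ.toFun (c * b)) : a = b :=
  τ.toDual_injective (LinearMap.ext h)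

end FaithfulTrace

section Seminorm

variable {V : Type*} [AddCommGroup V] [Module ℂ V]

/-- The triangle inequality for the seminorm of a positive semidefinite form. -/
theorem sqrt_re_apply_add_le (S : V →ₗ⋆[ℂ] V →ₗ[ℂ] ℂ) (hstar : ∀ x y, star (S x y) = S y x)
    (hpos : ∀ x, 0 ≤ S x x) (x y : V) :
    √(S (x + y) (x + y)).re ≤ √(S x x).re + √(S y y).re := by
  let c : PreInnerProductSpace.Core ℂ V :=
    { inner := fun x y => S x y
      conj_inner_symm := fun x y => hstar y x
      re_inner_nonneg := fun x => (Complex.le_def.mp (hpos x)).1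
      add_left := fun x y z => by simp
      smul_left := fun x y r => by simp }
  let _ := InnerProductSpace.Core.toSeminormedAddCommGroup (c := c)
  exact norm_add_le x y

end Seminorm

namespace RiemannianMetric

variable {A : Type u} [CStarAlgebra A] [PartialOrder A] (M : RiemannianMetric.{u, v} A)
  (τ : FaithfulTrace A)

/-- The scalar-valued form `τ(⟨ω, η⟩)` on the bimodule of one-forms. -/
def traceForm : M.Ω →ₗ⋆[ℂ] M.Ω →ₗ[ℂ] ℂ :=
  LinearMap.mk₂'ₛₗ (starRingEnd ℂ) (RingHom.id ℂ) (fun ω η => τ.toFun (M.form ω η))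
    (by simp) (by simp) (by simp) (by simp)

theorem traceForm_apply (ω η : M.Ω) : M.traceForm τ ω η = τ.toFun (M.form ω η) := rfl

theorem energyForm_eq_traceForm (a b : A) :
    M.energyForm τ a b = M.traceForm τ (M.d a) (M.d b) := rfl

theorem star_traceForm (ω η : M.Ω) : star (M.traceForm τ ω η) = M.traceForm τ η ω := by
  rw [traceForm_apply, ← τ.map_star, M.form_star, traceForm_apply]

theorem traceForm_left (a : A) (ω η : M.Ω) :
    M.traceForm τ (a • ω) η = M.traceForm τ ω (star a • η) := by
  rw [traceForm_apply, M.form_left, traceForm_apply]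

theorem form_op_smul_left (ω η : M.Ω) (a : A) :
    M.form (MulOpposite.op a • ω) η = star a * M.form ω η := by
  rw [← M.form_star, M.form_right, star_mul, M.form_star]

theorem traceForm_right (a : A) (ω η : M.Ω) :
    M.traceForm τ (MulOpposite.op a • ω) η = M.traceForm τ ω (MulOpposite.op (star a) • η) := by
  rw [traceForm_apply, traceForm_apply, form_op_smul_left, M.form_right, τ.tracial]

theorem d_one : M.d 1 = 0 := by
  simpa using M.leibniz 1 1

theorem op_smul_d (a b : A) : MulOpposite.op b • M.d a = M.d (a * b) - a • M.d b := by
  rw [M.leibniz, add_sub_cancel_right]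

theorem smul_d (a b : A) : a • M.d b = M.d (a * b) - MulOpposite.op b • M.d a := by
  rw [M.leibniz, add_sub_cancel_left]

theorem energyForm_eq_zero_of_carreDuChamp_eq_zero {a : A} (h : M.carreDuChamp a a = 0) :
    M.energyForm τ a a = 0 := by
  change τ.toFun (M.carreDuChamp a a) = 0
  rw [h, map_zero]

/-- After moving `y` and `y'` across and applying the Leibniz rule, the term `⟨d(x'*), d(y' y*) x*⟩`
occurs in the two summands with opposite signs. Only values of the energy form remain. -/
theorem traceForm_add_traceForm (x x' y y' : A) :
    M.traceForm τ (MulOpposite.op y • M.d x) (MulOpposite.op y' • M.d x') +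
        M.traceForm τ (star y' • M.d (star x')) (star y • M.d (star x)) =
      M.energyForm τ x (x' * (y' * star y)) - M.energyForm τ (star x' * x) (y' * star y) +
        M.energyForm τ (star x') (y' * star y * star x) := by
  have h1 : M.traceForm τ (MulOpposite.op y • M.d x) (MulOpposite.op y' • M.d x') =
      M.traceForm τ (M.d x) (M.d (x' * (y' * star y))) -
        (M.traceForm τ (M.d (star x' * x)) (M.d (y' * star y)) -
          M.traceForm τ (M.d (star x')) (MulOpposite.op (star x) • M.d (y' * star y))) := by
    rw [traceForm_right, smul_smul, ← MulOpposite.op_mul, op_smul_d, map_sub]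
    congr 1
    rw [← traceForm_right, ← LinearMap.sub_apply, ← map_sub, ← smul_d, traceForm_left, star_star]
  have h2 : M.traceForm τ (star y' • M.d (star x')) (star y • M.d (star x)) =
      M.traceForm τ (M.d (star x')) (M.d (y' * star y * star x)) -
        M.traceForm τ (M.d (star x')) (MulOpposite.op (star x) • M.d (y' * star y)) := by
    rw [traceForm_left, star_star, smul_smul, smul_d, map_sub]
  rw [h1, h2]
  simp only [energyForm_eq_traceForm]
  ring

variable [StarOrderedRing A]

theorem traceForm_nonneg (ω : M.Ω) : 0 ≤ M.traceForm τ ω ω :=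
  τ.apply_nonneg (M.form_nonneg ω)

theorem carreDuChamp_eq_zero_of_energyForm_eq_zero {a : A} (h : M.energyForm τ a a = 0) :
    M.carreDuChamp a a = 0 :=
  τ.eq_zero_of_nonneg (M.form_nonneg _) h

/-- A real energy form is completely Dirichlet. -/
theorem isCompletelyDirichlet_energyForm (hreal : IsRealForm (M.energyForm τ)) :
    IsCompletelyDirichlet (M.energyForm τ) where
  star_apply a b := M.star_traceForm τ _ _
  nonneg a := M.traceForm_nonneg τ _
  apply_one a := by rw [energyForm_eq_traceForm, d_one, map_zero]
  real := hreal
  condNeg := by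
    intro n x y hxy
    have h1 := M.traceForm_nonneg τ (∑ i, MulOpposite.op (y i) • M.d (x i))
    have h2 := M.traceForm_nonneg τ (∑ i, star (y i) • M.d (star (x i)))
    simp only [map_sum, LinearMap.sum_apply] at h1 h2
    rw [Finset.sum_comm] at h1
    have h3 := add_nonneg h1 h2
    -- Of the three terms of `traceForm_add_traceForm`, the two outer ones sum to zero, as they
    -- contain `∑ xⱼ yⱼ` or its adjoint; reality brings the middle one to the required form.
    have h4 : ∑ i, ∑ j, M.energyForm τ (x i) (x j * (y j * star (y i))) = 0 := by
      refine Finset.sum_eq_zero fun i _ => ?_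
      simp only [← map_sum, ← mul_assoc, ← Finset.sum_mul, hxy, zero_mul, map_zero]
    have h5 : ∑ i, ∑ j, M.energyForm τ (star (x j)) (y j * star (y i) * star (x i)) = 0 := by
      rw [Finset.sum_comm]
      refine Finset.sum_eq_zero fun j _ => ?_
      simp only [← map_sum, mul_assoc, ← Finset.mul_sum, ← star_mul, ← star_sum, hxy, star_zero,
        mul_zero, map_zero]
    have h6 : ∀ i j, M.energyForm τ (star (x j) * x i) (y j * star (y i)) =
        M.energyForm τ (y i * star (y j)) (star (x i) * x j) := fun i j => by
      rw [← hreal]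
      simp
    have h7 : 0 ≤ -∑ i, ∑ j, M.energyForm τ (y i * star (y j)) (star (x i) * x j) := by
      refine h3.trans_eq ?_
      rw [← Finset.sum_add_distrib]
      simp only [← Finset.sum_add_distrib, traceForm_add_traceForm]
      simp only [Finset.sum_add_distrib, Finset.sum_sub_distrib, h4, h5, h6]
      ring
    have h8 := (Complex.le_def.mp h7).1
    rw [Complex.neg_re, Complex.zero_re] at h8
    linarith

/-- The energy norm of a Riemannian metric satisfies the Leibniz inequality. -/
theorem isLeibniz_energyNorm : IsLeibniz (energyNorm (M.energyForm τ)) := by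
  have hsq : ∀ (t r : ℝ), 0 ≤ t → √(t ^ 2 * r) = t * √r := fun t r ht => by
    rw [Real.sqrt_mul (sq_nonneg t), Real.sqrt_sq ht]
  have hle : ∀ c : A, star c * c ≤ ((‖c‖ ^ 2 : ℝ) : ℂ) • (1 : A) := fun c => by
    have := (IsSelfAdjoint.star_mul_self c).le_algebraMap_norm_self
    rw [CStarRing.norm_star_mul_self, ← sq] at this
    rwa [Algebra.algebraMap_eq_smul_one, ← Complex.coe_smul] at this
  -- With `⟨ω, ω⟩ = s* s`, traciality rewrites `τ(b* s* s b)` as `τ(s b b* s*)`, and `b b* ≤ ‖b‖²`.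
  have hright : ∀ (ω : M.Ω) (b : A), √(M.traceForm τ (MulOpposite.op b • ω)
      (MulOpposite.op b • ω)).re ≤ ‖b‖ * √(M.traceForm τ ω ω).re := fun ω b => by
    rw [← hsq _ _ (norm_nonneg b)]
    refine Real.sqrt_le_sqrt ?_
    obtain ⟨s, hs⟩ := CStarAlgebra.nonneg_iff_eq_star_mul_self.mp (M.form_nonneg ω)
    have h1 : M.traceForm τ (MulOpposite.op b • ω) (MulOpposite.op b • ω) =
        τ.toFun (s * (star (star b) * star b) * star s) := by
      rw [traceForm_apply, form_op_smul_left, M.form_right, hs, star_star, τ.tracial]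
      rw [τ.tracial (s * _)]
      simp only [mul_assoc]
    have h2 := τ.re_apply_mono (star_right_conjugate_le_conjugate (hle (star b)) s)
    rw [h1]
    refine h2.trans_eq ?_
    rw [mul_smul_comm, mul_one, smul_mul_assoc, map_smul, norm_star, τ.tracial, ← hs,
      traceForm_apply, smul_eq_mul, Complex.re_ofReal_mul]
  -- With `‖b‖² - b* b = s* s`, the estimate is the positivity of the form at `s • ω`.
  have hleft : ∀ (ω : M.Ω) (b : A), √(M.traceForm τ (b • ω) (b • ω)).re ≤
      ‖b‖ * √(M.traceForm τ ω ω).re := fun ω b => by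
    rw [← hsq _ _ (norm_nonneg b)]
    refine Real.sqrt_le_sqrt ?_
    obtain ⟨s, hs⟩ := CStarAlgebra.nonneg_iff_eq_star_mul_self.mp (sub_nonneg.mpr (hle b))
    have h1 := (Complex.le_def.mp (M.traceForm_nonneg τ (s • ω))).1
    rw [traceForm_left, smul_smul, ← hs, sub_smul, smul_assoc, one_smul, map_sub, map_smul,
      ← smul_smul, ← traceForm_left, Complex.sub_re, smul_eq_mul, Complex.re_ofReal_mul,
      Complex.zero_re] at h1
    linarith
  intro a b
  simp only [energyNorm, energyForm_eq_traceForm, M.leibniz]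
  refine (sqrt_re_apply_add_le (M.traceForm τ) (M.star_traceForm τ) (M.traceForm_nonneg τ)
    _ _).trans (add_le_add ?_ (hleft _ _))
  rw [mul_comm]
  exact hright _ _

end RiemannianMetric

/-! ### The Riemannian metric of a completely Dirichlet form -/

open scoped TensorProduct
open MulOpposite (op unop)

/-- Testing with `c = K`, the negative part of `g`, gives `-τ(K³) ≥ 0`, which forces `K = 0`. -/
theorem FaithfulTrace.nonneg_of_forall_apply_nonneg {B : Type w} [CStarAlgebra B] [PartialOrder B]
    [StarOrderedRing B] (τ : FaithfulTrace B) {g : B} (hg : IsSelfAdjoint g)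
    (h : ∀ c : B, 0 ≤ τ.toFun (c * star c * g)) : 0 ≤ g := by
  obtain ⟨x, y, rfl, hxy⟩ := exists_star_mul_self_sub_star_mul_self hg
  set K := star y * y with hK
  have hKs : star K = K := by simp [hK]
  have hKU : K * (star x * x) = 0 := by
    have := congrArg star hxy
    simpa [hKs] using this
  have h1 := h K
  have h2 : K * star K * (star x * x - K) = -(star (y * K) * (y * K)) := by
    rw [hKs, mul_sub, mul_assoc, hKU, mul_zero, zero_sub, star_mul, hKs]
    simp [hK, mul_assoc]
  rw [h2, map_neg, Left.nonneg_neg_iff] at h1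
  have h3 : y * K = 0 := τ.faithful _ (le_antisymm h1 (τ.nonneg _))
  have h4 : K = 0 := by
    rw [← CStarRing.star_mul_self_eq_zero_iff, hKs]
    nth_rewrite 1 [hK]
    rw [mul_assoc, h3, mul_zero]
  rw [h4, sub_zero]
  exact star_mul_self_nonneg x

/-- Cauchy–Schwarz for a semidefinite form. -/
theorem apply_eq_zero_of_apply_self_eq_zero {V : Type*} [AddCommGroup V] [Module ℂ V]
    (S : V →ₗ⋆[ℂ] V →ₗ[ℂ] ℂ) (hstar : ∀ x y, star (S x y) = S y x) (hpos : ∀ x, 0 ≤ S x x)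
    (x : V) {y : V} (hy : S y y = 0) : S x y = 0 := by
  let c : PreInnerProductSpace.Core ℂ V :=
    { inner := fun x y => S x y
      conj_inner_symm := fun x y => hstar y x
      re_inner_nonneg := fun x => (Complex.le_def.mp (hpos x)).1
      add_left := fun x y z => by simp
      smul_left := fun x y r => by simp }
  have h := InnerProductSpace.Core.inner_mul_inner_self_le (c := c) x y
  change ‖S x y‖ * ‖S y x‖ ≤ (S x x).re * (S y y).re at h
  rw [← hstar x y, norm_star, hy, Complex.zero_re, mul_zero] at h
  exact norm_eq_zero.mp (mul_self_eq_zero.mp (le_antisymm h (mul_self_nonneg _)))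

/-! ### The enveloping algebra and universal one-forms. -/

section Enveloping

/-- The enveloping algebra `B ⊗ Bᵒᵖ`. -/
def Enveloping (B : Type w) [Ring B] [Algebra ℂ B] : Type w := B ⊗[ℂ] Bᵐᵒᵖ

namespace Enveloping

section Algebra

variable (B : Type w) [Ring B] [Algebra ℂ B]

instance : Ring (Enveloping B) := inferInstanceAs (Ring (B ⊗[ℂ] Bᵐᵒᵖ))

instance : Algebra ℂ (Enveloping B) := inferInstanceAs (Algebra ℂ (B ⊗[ℂ] Bᵐᵒᵖ))

variable {B}

/-- The left action of `B`, as a map to the enveloping algebra. -/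
def left : B →ₐ[ℂ] Enveloping B :=
  (Algebra.TensorProduct.includeLeft : B →ₐ[ℂ] B ⊗[ℂ] Bᵐᵒᵖ)

/-- The right action of `B`, as a map to the enveloping algebra. -/
def right : Bᵐᵒᵖ →ₐ[ℂ] Enveloping B :=
  (Algebra.TensorProduct.includeRight : Bᵐᵒᵖ →ₐ[ℂ] B ⊗[ℂ] Bᵐᵒᵖ)

theorem left_mul_right (a : B) (b : Bᵐᵒᵖ) :
    left a * right b = (a ⊗ₜ[ℂ] b : B ⊗[ℂ] Bᵐᵒᵖ) := by
  refine (Algebra.TensorProduct.tmul_mul_tmul a 1 1 b).trans ?_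
  rw [mul_one, one_mul]

theorem right_mul_left (a : B) (b : Bᵐᵒᵖ) : right b * left a = left a * right b := by
  rw [left_mul_right]
  refine (Algebra.TensorProduct.tmul_mul_tmul 1 a b 1).trans ?_
  rw [mul_one, one_mul]

theorem left_mul_right_mul (a a' : B) (b b' : Bᵐᵒᵖ) :
    left a * right b * (left a' * right b') = left (a * a') * right (b * b') := by
  rw [map_mul, map_mul, mul_assoc, ← mul_assoc (right b), right_mul_left]
  simp only [mul_assoc]

theorem induction_on {P : Enveloping B → Prop} (e : Enveloping B) (zero : P 0)
    (mul : ∀ a b, P (left a * right b)) (add : ∀ e e', P e → P e' → P (e + e')) : P e :=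
  TensorProduct.induction_on (R := ℂ) (M := B) (N := Bᵐᵒᵖ) (motive := P) e zero
    (fun a b => left_mul_right a b ▸ mul a b) add

theorem exists_eq_sum (e : Enveloping B) :
    ∃ (n : ℕ) (x y : Fin n → B), e = ∑ i, left (x i) * right (op (y i)) := by
  obtain ⟨S, hS⟩ := TensorProduct.exists_finset (R := ℂ) (M := B) (N := Bᵐᵒᵖ) e
  refine ⟨S.card, fun i => (S.equivFin.symm i).1.1, fun i => unop (S.equivFin.symm i).1.2, ?_⟩
  rw [Equiv.sum_comp S.equivFin.symm
    (fun i : S => left (B := B) i.1.1 * right (op (unop i.1.2))), hS, ← Finset.sum_coe_sort]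
  exact Finset.sum_congr rfl fun i _ => (left_mul_right _ _).symm

/-- The linear map on the enveloping algebra given by a bilinear map. -/
def lift {V : Type*} [AddCommGroup V] [Module ℂ V] (f : B →ₗ[ℂ] Bᵐᵒᵖ →ₗ[ℂ] V) :
    Enveloping B →ₗ[ℂ] V :=
  (TensorProduct.lift f : B ⊗[ℂ] Bᵐᵒᵖ →ₗ[ℂ] V)

theorem lift_mul {V : Type*} [AddCommGroup V] [Module ℂ V] (f : B →ₗ[ℂ] Bᵐᵒᵖ →ₗ[ℂ] V)
    (a : B) (b : Bᵐᵒᵖ) : lift f (left a * right b) = f a b := by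
  rw [left_mul_right]
  rfl

/-- The multiplication map `a ⊗ x ↦ a x`. -/
def mulMap : Enveloping B →ₗ[ℂ] B :=
  lift (LinearMap.mk₂ ℂ (fun a x => a * unop x) (by simp [add_mul]) (by simp)
    (by simp [mul_add]) (by simp))

theorem mulMap_mul (a : B) (x : Bᵐᵒᵖ) : mulMap (left a * right x) = a * unop x :=
  lift_mul _ _ _

theorem mulMap_left (a : B) : mulMap (left a) = a := by
  simpa using mulMap_mul a 1

theorem mulMap_right (x : Bᵐᵒᵖ) : mulMap (right x) = unop x := by
  simpa using mulMap_mul (1 : B) x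

theorem mulMap_mul_mul (c : B) (z : Bᵐᵒᵖ) (e : Enveloping B) :
    mulMap (left c * right z * e) = c * mulMap e * unop z := by
  induction e using induction_on with
  | zero => simp
  | mul a x =>
    rw [left_mul_right_mul, mulMap_mul, mulMap_mul, MulOpposite.unop_mul]
    simp only [mul_assoc]
  | add e e' he he' => rw [mul_add, map_add, he, he', map_add, mul_add, add_mul]

/-- The kernel of the multiplication, that is, the universal one-forms. -/
def universalForms : Submodule (Enveloping B) (Enveloping B) where
  carrier := {e | mulMap e = 0}
  zero_mem' := map_zero _
  add_mem' {e e'} he he' := by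
    change mulMap (e + e') = 0
    rw [map_add, show mulMap e = 0 from he, show mulMap e' = 0 from he', add_zero]
  smul_mem' c e he := by
    change mulMap (c * e) = 0
    induction c using induction_on with
    | zero => simp
    | mul a x => rw [mulMap_mul_mul, show mulMap e = 0 from he, mul_zero, zero_mul]
    | add c c' hc hc' => rw [add_mul, map_add, hc, hc', add_zero]

theorem mem_universalForms {e : Enveloping B} : e ∈ universalForms ↔ mulMap e = 0 := Iff.rfl

/-- The universal derivation `a ↦ a ⊗ 1 - 1 ⊗ a`. -/
def universalDerivation : B →ₗ[ℂ] universalForms (B := B) where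
  toFun a := ⟨left a - right (op a), by simp [mem_universalForms, mulMap_left, mulMap_right]⟩
  map_add' a b := by
    ext
    simp [add_sub_add_comm]
  map_smul' z a := by
    ext
    simp [smul_sub]

theorem coe_universalDerivation (a : B) :
    (universalDerivation a : Enveloping B) = left a - right (op a) := rfl

end Algebra

section Star

variable {B : Type w} [Ring B] [Algebra ℂ B] [StarRing B] [StarModule ℂ B]

instance : StarRing (Enveloping B) := inferInstanceAs (StarRing (B ⊗[ℂ] Bᵐᵒᵖ))

instance : StarModule ℂ (Enveloping B) := inferInstanceAs (StarModule ℂ (B ⊗[ℂ] Bᵐᵒᵖ))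

theorem star_left (a : B) : star (left a) = left (star a) := by
  refine (TensorProduct.star_tmul a (1 : Bᵐᵒᵖ)).trans ?_
  rw [star_one]
  rfl

theorem star_right (b : Bᵐᵒᵖ) : star (right b) = right (star b) := by
  refine (TensorProduct.star_tmul (1 : B) b).trans ?_
  rw [star_one]
  rfl

theorem star_mul_right (a : B) (b : Bᵐᵒᵖ) :
    star (left a * right b) = left (star a) * right (star b) := by
  rw [star_mul, star_left, star_right, right_mul_left]

end Star

/-- The linear functional `c ⊗ z ↦ -E(z*, c) / 2` on the enveloping algebra. -/
def functional {B : Type w} [CStarAlgebra B] (E : B →ₗ⋆[ℂ] B →ₗ[ℂ] ℂ) : Enveloping B →ₗ[ℂ] ℂ :=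
  lift (LinearMap.mk₂ ℂ (fun c z => -(1 / 2 : ℂ) * E (star (unop z)) c)
    (by intros; simp; ring) (by intros; simp; ring) (by intros; simp; ring)
    (by intros; simp; ring))

theorem functional_mul {B : Type w} [CStarAlgebra B] (E : B →ₗ⋆[ℂ] B →ₗ[ℂ] ℂ) (c : B) (z : Bᵐᵒᵖ) :
    functional E (left c * right z) = -(1 / 2 : ℂ) * E (star (unop z)) c :=
  lift_mul _ _ _

theorem functional_left {B : Type w} [CStarAlgebra B] (E : B →ₗ⋆[ℂ] B →ₗ[ℂ] ℂ) (c : B) :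
    functional E (left c) = -(1 / 2 : ℂ) * E 1 c := by
  simpa using functional_mul E c 1

theorem functional_right {B : Type w} [CStarAlgebra B] (E : B →ₗ⋆[ℂ] B →ₗ[ℂ] ℂ) (z : Bᵐᵒᵖ) :
    functional E (right z) = -(1 / 2 : ℂ) * E (star (unop z)) 1 := by
  simpa using functional_mul E 1 z

end Enveloping

end Enveloping

/-! ### The GNS-type construction of one-forms and of their inner product. -/

namespace IsCompletelyDirichlet

open Enveloping

variable {B : Type w} [CStarAlgebra B] {E : B →ₗ⋆[ℂ] B →ₗ[ℂ] ℂ}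

theorem functional_star (hE : IsCompletelyDirichlet E) (e : Enveloping B) :
    functional E (star e) = star (functional E e) := by
  induction e using induction_on with
  | zero => simp
  | mul c z =>
    rw [star_mul_right, functional_mul, functional_mul, star_mul', hE.star_apply,
      ← hE.real (star (unop z)) c]
    simp
  | add e e' he he' => rw [star_add, map_add, he, he', map_add, star_add]

/-- For `e = ∑ xᵢ ⊗ yᵢ`, lying in the kernel of multiplication means `∑ xᵢ yᵢ = 0`, and the value is
`-1/2` times the sum in the conditional negativity. -/
theorem functional_nonneg (hE : IsCompletelyDirichlet E) {e : Enveloping B}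
    (he : e ∈ universalForms) : 0 ≤ functional E (star e * e) := by
  have him : (functional E (star e * e)).im = 0 := by
    have h := hE.functional_star (star e * e)
    rw [star_mul, star_star] at h
    exact Complex.conj_eq_iff_im.mp h.symm
  obtain ⟨n, x, y, rfl⟩ := exists_eq_sum e
  have hxy : ∑ i, x i * y i = 0 := by simpa [mem_universalForms, mulMap_mul] using he
  have h := hE.condNeg n x y hxy
  refine Complex.le_def.mpr ⟨?_, him.symm⟩
  have key : functional E (star (∑ i, left (x i) * right (op (y i))) *
      ∑ i, left (x i) * right (op (y i))) =
      -(1 / 2 : ℂ) * ∑ i, ∑ j, E (y i * star (y j)) (star (x i) * x j) := by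
    rw [star_sum, Finset.sum_mul_sum]
    simp only [star_mul_right, map_sum, left_mul_right_mul,
      functional_mul, Finset.mul_sum]
    simp
  rw [key, show -(1 / 2 : ℂ) = ((-(1 / 2) : ℝ) : ℂ) by push_cast; ring, Complex.re_ofReal_mul,
    Complex.zero_re]
  linarith

variable (E) in
/-- The form `(ω, η) ↦ φ(ω* η)` on the universal one-forms. -/
def universalForm : universalForms (B := B) →ₗ⋆[ℂ] universalForms (B := B) →ₗ[ℂ] ℂ :=
  LinearMap.mk₂'ₛₗ (starRingEnd ℂ) (RingHom.id ℂ)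
    (fun ω η => functional E (star (ω : Enveloping B) * η))
    (by intros; simp [add_mul]) (by intros; simp) (by intros; simp [mul_add]) (by intros; simp)

theorem universalForm_apply (ω η : universalForms (B := B)) :
    universalForm E ω η = functional E (star (ω : Enveloping B) * η) := rfl

theorem star_universalForm (hE : IsCompletelyDirichlet E) (ω η : universalForms (B := B)) :
    star (universalForm E ω η) = universalForm E η ω := by
  rw [universalForm_apply, ← hE.functional_star, star_mul, star_star, universalForm_apply]

theorem universalForm_smul_left (c : Enveloping B) (ω η : universalForms (B := B)) :
    universalForm E (c • ω) η = universalForm E ω (star c • η) := by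
  simp [universalForm_apply, mul_assoc]

variable (E) in
/-- The null space of the form on the universal one-forms. -/
def nullForms : Submodule (Enveloping B) (universalForms (B := B)) where
  carrier := {ω | ∀ η, universalForm E η ω = 0}
  zero_mem' η := map_zero _
  add_mem' {ω ω'} hω hω' η := by rw [map_add, hω, hω', add_zero]
  smul_mem' c ω hω η := by
    rw [← star_star c, ← universalForm_smul_left, hω]

variable (E) in
/-- The bimodule of one-forms of a completely Dirichlet form. -/
def OneForms : Type w := universalForms (B := B) ⧸ nullForms E

instance : AddCommGroup (OneForms E) :=
  inferInstanceAs (AddCommGroup (universalForms (B := B) ⧸ nullForms E))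

instance : Module (Enveloping B) (OneForms E) :=
  inferInstanceAs (Module (Enveloping B) (universalForms (B := B) ⧸ nullForms E))

instance : Module ℂ (OneForms E) :=
  inferInstanceAs (Module ℂ (universalForms (B := B) ⧸ nullForms E))

instance : IsScalarTower ℂ (Enveloping B) (OneForms E) :=
  inferInstanceAs (IsScalarTower ℂ (Enveloping B) (universalForms (B := B) ⧸ nullForms E))

instance : Module B (OneForms E) := Module.compHom _ (left (B := B)).toRingHom

instance : Module Bᵐᵒᵖ (OneForms E) := Module.compHom _ (right (B := B)).toRingHom

namespace OneForms

theorem smul_def (a : B) (ω : OneForms E) : a • ω = left a • ω := rfl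

theorem op_smul_def (b : Bᵐᵒᵖ) (ω : OneForms E) : b • ω = right b • ω := rfl

instance : SMulCommClass B Bᵐᵒᵖ (OneForms E) where
  smul_comm a b ω := by
    simp only [smul_def, op_smul_def, smul_smul, right_mul_left]

instance : IsScalarTower ℂ B (OneForms E) where
  smul_assoc z a ω := by simp only [smul_def, map_smul, smul_assoc]

instance : IsScalarTower ℂ Bᵐᵒᵖ (OneForms E) where
  smul_assoc z a ω := by simp only [op_smul_def, map_smul, smul_assoc]

variable (E) in
/-- The class of a universal one-form. -/
def mk : universalForms (B := B) →ₗ[Enveloping B] OneForms E := (nullForms E).mkQ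

theorem mk_surjective : Function.Surjective (mk E) := (nullForms E).mkQ_surjective

theorem mk_eq_zero {ω : universalForms (B := B)} :
    mk E ω = 0 ↔ ∀ η, universalForm E η ω = 0 :=
  Submodule.Quotient.mk_eq_zero (nullForms E)

variable (E) in
/-- The derivation into the one-forms. -/
def derivation : B →ₗ[ℂ] OneForms E := (mk E).restrictScalars ℂ ∘ₗ universalDerivation

theorem derivation_apply (a : B) : derivation E a = mk E (universalDerivation a) := rfl

theorem derivation_mul (a b : B) :
    derivation E (a * b) = op b • derivation E a + a • derivation E b := by
  rw [op_smul_def, smul_def, derivation_apply, derivation_apply, derivation_apply, ← (mk E).map_smul,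
    ← (mk E).map_smul, ← (mk E).map_add]
  congr 1
  ext
  simp [coe_universalDerivation, mul_sub, right_mul_left]

/-- Since `a ⊗ x - 1 ⊗ a x = (d a) x`, subtracting `1 ⊗ m(e)`, with `m` the multiplication, projects
the enveloping algebra onto combinations of the `(d a) x`. Elements with `m(e) = 0` are fixed by
this projection. -/
theorem eq_top_of_derivation_mem (W : Submodule ℂ (OneForms E)) (hd : ∀ a, derivation E a ∈ W)
    (hright : ∀ (a : B), ∀ ω ∈ W, op a • ω ∈ W) : W = ⊤ := by
  have key : ∀ (e : Enveloping B) (h : e - right (op (mulMap e)) ∈ universalForms),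
      mk E ⟨e - right (op (mulMap e)), h⟩ ∈ W := by
    intro e
    induction e using induction_on with
    | zero =>
      intro h
      convert! W.zero_mem
      rw [← map_zero (mk E)]
      congr 1
      ext
      simp
    | mul a x =>
      intro h
      convert! hright (unop x) _ (hd a)
      rw [op_smul_def, derivation_apply, ← map_smul]
      congr 1
      ext
      simp [coe_universalDerivation, mul_sub, right_mul_left, mulMap_mul]
    | add e e' he he' =>
      intro h
      have hmem : ∀ c : Enveloping B, c - right (op (mulMap c)) ∈ universalForms := fun c => by
        simp [mem_universalForms, mulMap_right]
      convert! W.add_mem (he (hmem e)) (he' (hmem e'))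
      rw [← map_add]
      congr 1
      ext
      simp [add_sub_add_comm]
  refine (Submodule.eq_top_iff').mpr fun ω => ?_
  obtain ⟨⟨e, he⟩, rfl⟩ := mk_surjective ω
  have h0 : e - right (op (mulMap e)) = e := by
    rw [mem_universalForms.mp he, MulOpposite.op_zero, map_zero, sub_zero]
  have := key e (by rwa [h0])
  simpa only [h0] using this

end OneForms

variable [FiniteDimensional ℂ B] (τ : FaithfulTrace B)

variable (E) in
/-- The `B`-valued form on the universal one-forms with `τ(b ⟨ω, η⟩) = φ(ω* (1 ⊗ b) η)`. -/
def universalInner (ω η : universalForms (B := B)) : B :=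
  τ.dualEquiv.symm (universalForm E ω ∘ₗ
    (LinearMap.toSpanSingleton (Enveloping B) _ η).restrictScalars ℂ ∘ₗ
      right.toLinearMap ∘ₗ (MulOpposite.opLinearEquiv ℂ).toLinearMap)

theorem trace_mul_universalInner (b : B) (ω η : universalForms (B := B)) :
    τ.toFun (b * universalInner E τ ω η) = universalForm E ω (right (op b) • η) := by
  change τ.dualEquiv (universalInner E τ ω η) b = _
  rw [universalInner, LinearEquiv.apply_symm_apply]
  rfl

theorem universalInner_congr (hE : IsCompletelyDirichlet E) {ω ω' η η' : universalForms (B := B)}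
    (hω : OneForms.mk E ω = OneForms.mk E ω') (hη : OneForms.mk E η = OneForms.mk E η') :
    universalInner E τ ω η = universalInner E τ ω' η' := by
  refine τ.ext_mul_left fun c => ?_
  rw [← sub_eq_zero, ← map_sub, OneForms.mk_eq_zero] at hω hη
  rw [trace_mul_universalInner, trace_mul_universalInner]
  have h1 : universalForm E ω (right (op c) • η) = universalForm E ω (right (op c) • η') := by
    rw [← star_star (right (op c)), ← universalForm_smul_left, ← universalForm_smul_left,
      ← sub_eq_zero, ← map_sub, hη]
  rw [h1, ← hE.star_universalForm, ← hE.star_universalForm _ ω']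
  congr 1
  rw [← sub_eq_zero, ← map_sub, hω]

variable (E) in
/-- The inner product of one-forms. -/
def oneFormsInner (ω η : OneForms E) : B :=
  universalInner E τ (Function.surjInv OneForms.mk_surjective ω)
    (Function.surjInv OneForms.mk_surjective η)

theorem trace_mul_oneFormsInner (hE : IsCompletelyDirichlet E) (b : B)
    (ω η : universalForms (B := B)) :
    τ.toFun (b * oneFormsInner E τ (OneForms.mk E ω) (OneForms.mk E η)) =
      universalForm E ω (right (op b) • η) := by
  rw [oneFormsInner, hE.universalInner_congr τ (Function.surjInv_eq _ _)
    (Function.surjInv_eq _ _), trace_mul_universalInner]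

/-- The form of the Riemannian metric of a completely Dirichlet form. -/
def metricForm (hE : IsCompletelyDirichlet E) : OneForms E →ₗ⋆[ℂ] OneForms E →ₗ[ℂ] B :=
  LinearMap.mk₂'ₛₗ (starRingEnd ℂ) (RingHom.id ℂ) (oneFormsInner E τ)
    (fun ω ω' η => by
      obtain ⟨ω, rfl⟩ := OneForms.mk_surjective ω
      obtain ⟨ω', rfl⟩ := OneForms.mk_surjective ω'
      obtain ⟨η, rfl⟩ := OneForms.mk_surjective η
      refine τ.ext_mul_left fun c => ?_
      rw [← (OneForms.mk E).map_add, mul_add, τ.toFun.map_add]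
      simp only [hE.trace_mul_oneFormsInner]
      rw [map_add, LinearMap.add_apply])
    (fun z ω η => by
      obtain ⟨ω, rfl⟩ := OneForms.mk_surjective ω
      obtain ⟨η, rfl⟩ := OneForms.mk_surjective η
      refine τ.ext_mul_left fun c => ?_
      rw [← (OneForms.mk E).map_smul_of_tower, mul_smul_comm, τ.toFun.map_smul]
      simp only [hE.trace_mul_oneFormsInner]
      rw [(universalForm E).map_smulₛₗ, LinearMap.smul_apply])
    (fun ω η η' => by
      obtain ⟨ω, rfl⟩ := OneForms.mk_surjective ω
      obtain ⟨η, rfl⟩ := OneForms.mk_surjective η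
      obtain ⟨η', rfl⟩ := OneForms.mk_surjective η'
      refine τ.ext_mul_left fun c => ?_
      rw [← (OneForms.mk E).map_add, mul_add, τ.toFun.map_add]
      simp only [hE.trace_mul_oneFormsInner]
      rw [smul_add, map_add])
    (fun z ω η => by
      obtain ⟨ω, rfl⟩ := OneForms.mk_surjective ω
      obtain ⟨η, rfl⟩ := OneForms.mk_surjective η
      refine τ.ext_mul_left fun c => ?_
      rw [← (OneForms.mk E).map_smul_of_tower, mul_smul_comm, τ.toFun.map_smul]
      simp only [hE.trace_mul_oneFormsInner]
      rw [smul_comm, map_smul, RingHom.id_apply])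

theorem trace_mul_metricForm (hE : IsCompletelyDirichlet E) (b : B)
    (ω η : universalForms (B := B)) :
    τ.toFun (b * hE.metricForm τ (OneForms.mk E ω) (OneForms.mk E η)) =
      universalForm E ω (right (op b) • η) :=
  hE.trace_mul_oneFormsInner τ b ω η

theorem star_metricForm (hE : IsCompletelyDirichlet E) (ω η : OneForms E) :
    star (hE.metricForm τ ω η) = hE.metricForm τ η ω := by
  obtain ⟨ω, rfl⟩ := OneForms.mk_surjective ω
  obtain ⟨η, rfl⟩ := OneForms.mk_surjective η
  refine τ.ext_mul_left fun c => ?_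
  rw [← star_star c, ← star_mul, τ.map_star, τ.tracial, hE.trace_mul_metricForm,
    hE.trace_mul_metricForm, hE.star_universalForm, universalForm_smul_left, star_right,
    MulOpposite.op_star, star_star, star_star]

/-- The Riemannian metric of a completely Dirichlet form. -/
def riemannianMetric [PartialOrder B] [StarOrderedRing B] (hE : IsCompletelyDirichlet E) :
    RiemannianMetric.{w, w} B where
  Ω := OneForms E
  d := OneForms.derivation E
  leibniz := OneForms.derivation_mul
  generates W hd _ hright := OneForms.eq_top_of_derivation_mem W hd hright
  form := hE.metricForm τ
  form_right ω η a := by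
    obtain ⟨ω, rfl⟩ := OneForms.mk_surjective ω
    obtain ⟨η, rfl⟩ := OneForms.mk_surjective η
    refine τ.ext_mul_left fun c => ?_
    rw [← mul_assoc, τ.tracial _ a, ← mul_assoc, hE.trace_mul_metricForm, OneForms.op_smul_def,
      ← map_smul, hE.trace_mul_metricForm, smul_smul, ← map_mul, MulOpposite.op_mul]
  form_star := hE.star_metricForm τ
  form_left a ω η := by
    obtain ⟨ω, rfl⟩ := OneForms.mk_surjective ω
    obtain ⟨η, rfl⟩ := OneForms.mk_surjective η
    refine τ.ext_mul_left fun c => ?_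
    rw [OneForms.smul_def, OneForms.smul_def, ← map_smul, ← map_smul, hE.trace_mul_metricForm,
      hE.trace_mul_metricForm, universalForm_smul_left, star_left, smul_smul, smul_smul,
      right_mul_left]
  form_nonneg ω := by
    refine τ.nonneg_of_forall_apply_nonneg (hE.star_metricForm τ ω ω) fun c => ?_
    obtain ⟨ω, rfl⟩ := OneForms.mk_surjective ω
    -- Right multiplication by `c c*` is a product of an operator and its adjoint, so the trace is
    -- the square of the one-form `ω c`.
    rw [hE.trace_mul_metricForm, MulOpposite.op_mul, map_mul, ← smul_smul, MulOpposite.op_star,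
      ← star_right, ← universalForm_smul_left]
    exact hE.functional_nonneg (Subtype.mem _)
  form_definite ω hω := by
    obtain ⟨ω, rfl⟩ := OneForms.mk_surjective ω
    refine OneForms.mk_eq_zero.mpr fun η =>
      apply_eq_zero_of_apply_self_eq_zero _ hE.star_universalForm
        (fun ω => hE.functional_nonneg (Subtype.mem _)) η ?_
    have h := hE.trace_mul_metricForm τ 1 ω ω
    rw [hω, mul_zero, map_zero, MulOpposite.op_one, map_one, one_smul] at h
    exact h.symm

/-- Expanding `φ((d a)* d b)`, with `φ` the functional of `E`, leaves `(E(a, b) + E(b*, a*)) / 2`,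
as the terms containing `1` vanish. Reality makes the two halves equal, whence the factor `1/2` in
the functional. -/
theorem energyForm_riemannianMetric [PartialOrder B] [StarOrderedRing B]
    (hE : IsCompletelyDirichlet E) : (hE.riemannianMetric τ).energyForm τ = E := by
  ext a b
  have h := hE.trace_mul_metricForm τ 1 (universalDerivation a) (universalDerivation b)
  rw [one_mul, MulOpposite.op_one, map_one, one_smul, universalForm_apply] at h
  refine h.trans ?_
  have h1 : E 1 (star a * b) = 0 := by rw [← hE.star_apply, hE.apply_one, star_zero]
  have h2 : E (star b) (star a) = E a b := hE.real b a
  simp only [coe_universalDerivation, star_sub, star_left, star_right, sub_mul, mul_sub, map_sub,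
    ← map_mul, right_mul_left, functional_mul, functional_left, functional_right]
  simp only [← MulOpposite.op_star, ← MulOpposite.op_mul, MulOpposite.unop_op, h1, h2,
    hE.apply_one, star_star]
  ring

end IsCompletelyDirichlet

/-! ### Quotient projections and harmonic lifts -/

section Projection

variable {A : Type u} [CStarAlgebra A] {B : Type w} [CStarAlgebra B] {π : A →⋆ₐ[ℂ] B} {p : A}

namespace IsQuotientProjection

theorem mul_self (hp : IsQuotientProjection π p) : p * p = p := hp.1.isIdempotentElem

theorem star_eq (hp : IsQuotientProjection π p) : star p = p := hp.1.isSelfAdjoint.star_eq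

theorem map_eq_one (hp : IsQuotientProjection π p) : π p = 1 := by
  have : π (1 - p) = 0 := (hp.2.2 _).mpr (by rw [mul_sub, mul_one, hp.mul_self, sub_self])
  rw [map_sub, map_one, sub_eq_zero] at this
  exact this.symm

theorem mul_eq_mul_iff (hp : IsQuotientProjection π p) {a a' : A} :
    p * a = p * a' ↔ π a = π a' := by
  rw [← sub_eq_zero, ← mul_sub, ← hp.2.2, map_sub, sub_eq_zero]

theorem eq_of_isQuotientProjection (hp : IsQuotientProjection π p) {p' : A}
    (hp' : IsQuotientProjection π p') : p = p' := by
  have h1 : p * p' = p * 1 := hp.mul_eq_mul_iff.mpr (by rw [hp'.map_eq_one, map_one])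
  have h2 : p' * p = p' * 1 := hp'.mul_eq_mul_iff.mpr (by rw [hp.map_eq_one, map_one])
  rw [mul_one] at h1 h2
  rw [← h1, hp.2.1, h2]

end IsQuotientProjection

/-- The pairing `τ(c x)` is nondegenerate on the `*`-closed ideal `ker π`. The element `q`
representing `τ` there is a two-sided unit of the ideal, hence a central projection, and `p = 1 -
q`. -/
theorem exists_isQuotientProjection [FiniteDimensional ℂ A] (τ : FaithfulTrace A)
    (π : A →⋆ₐ[ℂ] B) : ∃ p : A, IsQuotientProjection π p := by
  let I : Submodule ℂ A := LinearMap.ker π.toAlgHom.toLinearMap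
  have hI : ∀ {a : A}, a ∈ I ↔ π a = 0 := Iff.rfl
  let T : I →ₗ[ℂ] Module.Dual ℂ I := I.subtype.dualMap ∘ₗ τ.toDual ∘ₗ I.subtype
  have hT : ∀ x y : I, T x y = τ.toFun (y * x : A) := fun x y => rfl
  have hinj : Function.Injective T := by
    rw [injective_iff_map_eq_zero]
    intro x hx
    have h := LinearMap.congr_fun hx ⟨star (x : A), hI.mpr (by rw [map_star, hI.mp x.2, star_zero])⟩
    exact Subtype.ext (τ.faithful _ h)
  obtain ⟨⟨q, hq⟩, hqT⟩ := (LinearMap.injective_iff_surjective_of_finrank_eq_finrank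
    Subspace.dual_finrank_eq.symm).mp hinj (τ.toFun ∘ₗ I.subtype)
  have hτ : ∀ c, π c = 0 → τ.toFun (c * q) = τ.toFun c := fun c hc =>
    LinearMap.congr_fun hqT ⟨c, hI.mpr hc⟩
  have hπq : π q = 0 := hq
  have hright : ∀ c, π c = 0 → c * q = c := fun c hc => τ.ext_mul_left fun a => by
    rw [← mul_assoc, hτ _ (by rw [map_mul, hc, mul_zero])]
  have hleft : ∀ c, π c = 0 → q * c = c := fun c hc => τ.ext_mul_left fun a => by
    rw [τ.tracial, mul_assoc, τ.tracial, hτ _ (by rw [map_mul, hc, zero_mul]), τ.tracial]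
  have hcen : ∀ a, q * a = a * q := fun a => by
    rw [← hright (q * a) (by rw [map_mul, hπq, zero_mul]), mul_assoc,
      hleft (a * q) (by rw [map_mul, hπq, mul_zero])]
  have hstar : star q = q := by
    have h1 : star q * q = star q := hright _ (by rw [map_star, hπq, star_zero])
    have h2 := congrArg star h1
    rw [star_mul, star_star] at h2
    rw [← h1, h2]
  have hqproj : IsStarProjection q := ⟨hright q hπq, hstar⟩
  refine ⟨1 - q, hqproj.one_sub, fun a => by rw [sub_mul, mul_sub, hcen, one_mul, mul_one],
    fun a => ⟨fun ha => by rw [sub_mul, one_mul, hleft a ha, sub_self], fun ha => ?_⟩⟩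
  rw [sub_mul, one_mul, sub_eq_zero] at ha
  rw [ha, map_mul, hπq, zero_mul]

theorem coe_toCorner (p a : A) : (toCorner p a : A) = p * a := rfl

theorem coe_block (T : A →ₗ[ℂ] A) (p q : A) (x : corner p) : (block T p q x : A) = q * T x := rfl

theorem mul_coe_corner (hp : IsIdempotentElem p) (x : corner p) : p * (x : A) = x := by
  obtain ⟨_, y, rfl⟩ := x
  simp [← mul_assoc, hp.eq]

variable {E : A →ₗ⋆[ℂ] A →ₗ[ℂ] ℂ} (τ : FaithfulTrace A)

/-- Pythagoras: any lift differs from `h b` by an element of `ker π`, which is orthogonal to `h b`,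
so the infimum is attained at `h b`. -/
theorem IsHarmonicLift.quotientSeminorm_eq {h : B →ₗ[ℂ] A} (hh : IsHarmonicLift E π h)
    (hE : IsCompletelyDirichlet E) (b : B) :
    quotientSeminorm π (energyNorm E) b = energyNorm (pullbackForm E h) b := by
  refine IsLeast.csInf_eq ⟨⟨h b, hh.map_apply b, rfl⟩, ?_⟩
  rintro _ ⟨a, ha, rfl⟩
  have h0 : π (a - h b) = 0 := by rw [map_sub, ha, hh.map_apply, sub_self]
  have h1 := hh.orthogonal _ b h0
  have h2 : E (h b) (a - h b) = 0 := by rw [← hE.star_apply, h1, star_zero]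
  have h3 : E a a = E (h b) (h b) + E (a - h b) (a - h b) := by
    have : E a a = E (h b + (a - h b)) (h b + (a - h b)) := by rw [add_sub_cancel]
    rw [this, E.map_add, LinearMap.add_apply, (E (h b)).map_add, (E (a - h b)).map_add, h1, h2]
    ring
  refine Real.sqrt_le_sqrt ?_
  rw [h3, Complex.add_re, pullbackForm_apply]
  exact le_add_of_nonneg_right (Complex.le_def.mp (hE.nonneg _)).1

/-- A linear section `g` need not be multiplicative, but `b ↦ p g(b)` is the inverse of `π` on `pA`.
Positivity and faithfulness of the restricted trace rest on this. -/
theorem IsQuotientProjection.mul_section_star_mul_self (hp : IsQuotientProjection π p)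
    {g : B →ₗ[ℂ] A} (hg : ∀ b, π (g b) = b) (a : B) :
    p * g (star a * a) = star (p * g a) * (p * g a) := by
  rw [star_mul, hp.star_eq, ← hp.2.1, mul_assoc, ← mul_assoc (star (g a)), ← hp.2.1, mul_assoc,
    ← mul_assoc p, hp.mul_self, hp.mul_eq_mul_iff, map_mul π, map_star π, hg, hg]

/-- The restriction to `B = pA` of a faithful trace. -/
def FaithfulTrace.quotient (τ : FaithfulTrace A) (hp : IsQuotientProjection π p) {g : B →ₗ[ℂ] A}
    (hg : ∀ b, π (g b) = b) : FaithfulTrace B where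
  toFun := τ.toFun ∘ₗ LinearMap.mulLeft ℂ p ∘ₗ g
  tracial a b := by
    have h : ∀ a b, p * g (a * b) = p * g a * g b := fun a b => by
      rw [mul_assoc, hp.mul_eq_mul_iff, map_mul π, hg, hg, hg]
    simp only [LinearMap.comp_apply, LinearMap.mulLeft_apply, h]
    rw [τ.tracial, ← mul_assoc, ← hp.2.1]
  nonneg a := by
    simp only [LinearMap.comp_apply, LinearMap.mulLeft_apply, hp.mul_section_star_mul_self hg]
    exact τ.nonneg _
  faithful a ha := by
    simp only [LinearMap.comp_apply, LinearMap.mulLeft_apply, hp.mul_section_star_mul_self hg] at ha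
    rw [← hg a, hp.2.2]
    exact τ.faithful _ ha

theorem FaithfulTrace.quotient_apply (hp : IsQuotientProjection π p) {g : B →ₗ[ℂ] A}
    (hg : ∀ b, π (g b) = b) (x : corner p) : (τ.quotient hp hg).toFun (π x) = τ.toFun x := by
  change τ.toFun (p * g (π x)) = _
  rw [hp.mul_eq_mul_iff.mpr (hg _), mul_coe_corner hp.1.isIdempotentElem]

variable [FiniteDimensional ℂ A]

theorem apply_eq_trace_of_mul_eq {q : A} (hq : IsStarProjection q) {c : A} (hc : q * c = c)
    (a : A) : E c a = τ.toFun (star c * (q * τ.laplacian E a)) := by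
  rw [τ.laplacian_spec, ← mul_assoc]
  congr 2
  nth_rewrite 1 [← hc]
  rw [star_mul, hq.isSelfAdjoint.star_eq]

/-- The diagonal block of the operator of a form is invertible if the form is definite there. -/
theorem isUnit_block_laplacian {q : A} (hq : IsStarProjection q)
    (hdef : ∀ c : A, q * c = c → E c c = 0 → c = 0) :
    IsUnit (block (τ.laplacian E) q q : Module.End ℂ (corner q)) := by
  refine (LinearMap.isUnit_iff_ker_eq_bot _).mpr (LinearMap.ker_eq_bot'.mpr fun x hx => ?_)
  have hqx := mul_coe_corner hq.isIdempotentElem x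
  refine Subtype.ext (hdef _ hqx ?_)
  rw [apply_eq_trace_of_mul_eq τ hq hqx, ← coe_block, hx]
  simp

/-- The map `x ↦ x - S⁻¹ J x` from `pA` to `A`. -/
def cornerLift (τ : FaithfulTrace A) (E : A →ₗ⋆[ℂ] A →ₗ[ℂ] ℂ) (p : A) : corner p →ₗ[ℂ] A :=
  (corner p).subtype - (corner (1 - p)).subtype ∘ₗ
    Ring.inverse (block (τ.laplacian E) (1 - p) (1 - p) : Module.End ℂ (corner (1 - p))) ∘ₗ
      block (τ.laplacian E) p (1 - p)

theorem map_cornerLift (hp : IsQuotientProjection π p) (x : corner p) :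
    π (cornerLift τ E p x) = π x := by
  have h : ∀ y : corner (1 - p), π y = 0 := fun y => by
    rw [hp.2.2, ← mul_coe_corner hp.1.one_sub.isIdempotentElem y, ← mul_assoc, mul_sub, mul_one,
      hp.mul_self, sub_self, zero_mul]
  simp [cornerLift, h]

theorem apply_cornerLift_eq_zero (hp : IsQuotientProjection π p)
    (hS : IsUnit (block (τ.laplacian E) (1 - p) (1 - p) : Module.End ℂ (corner (1 - p))))
    (x : corner p) {c : A} (hc : p * c = 0) : E c (cornerLift τ E p x) = 0 := by
  rw [apply_eq_trace_of_mul_eq τ hp.1.one_sub (by rw [sub_mul, one_mul, hc, sub_zero])]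
  set J := block (τ.laplacian E) p (1 - p)
  set S : Module.End ℂ (corner (1 - p)) := block (τ.laplacian E) (1 - p) (1 - p) with hSdef
  have h1 : S (Ring.inverse S (J x)) = J x := by
    rw [← Module.End.mul_apply, Ring.mul_inverse_cancel _ hS, Module.End.one_apply]
  -- The component off `p` is `J x - S S⁻¹ J x`; this is where the choice of the lift comes from.
  have h2 : (1 - p) * τ.laplacian E (cornerLift τ E p x) = 0 := by
    have h3 : (1 - p) * τ.laplacian E (cornerLift τ E p x) =
        (J x : A) - (S (Ring.inverse S (J x)) : A) := by
      change _ * τ.laplacian E ((x : A) - (Ring.inverse S (J x) : A)) = _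
      rw [map_sub, mul_sub]
      rfl
    rw [h3, h1, sub_self]
  rw [h2, mul_zero, map_zero]

/-- Pairing with `b = p b` sees only the `p`-component of the operator of `E` applied to the lift,
which is the Schur complement applied to `b'`. -/
theorem quotientForm_eq_apply_cornerLift (hp : IsQuotientProjection π p) (b b' : corner p) :
    quotientForm τ E p b b' = E b (cornerLift τ E p b') := by
  rw [apply_eq_trace_of_mul_eq τ hp.1 (mul_coe_corner hp.1.isIdempotentElem b), quotientForm]
  congr 2
  simp only [schurComplement, cornerLift, LinearMap.sub_apply, LinearMap.comp_apply, map_sub,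
    Submodule.coe_sub, coe_block, mul_sub, Submodule.subtype_apply]

/-- The harmonic lift determined by a linear section of `π`. -/
def harmonicLift (τ : FaithfulTrace A) (E : A →ₗ⋆[ℂ] A →ₗ[ℂ] ℂ) (p : A) (g : B →ₗ[ℂ] A) :
    B →ₗ[ℂ] A :=
  cornerLift τ E p ∘ₗ toCorner p ∘ₗ g

theorem isHarmonicLift_harmonicLift (hp : IsQuotientProjection π p)
    (hS : IsUnit (block (τ.laplacian E) (1 - p) (1 - p) : Module.End ℂ (corner (1 - p))))
    {g : B →ₗ[ℂ] A} (hg : ∀ b, π (g b) = b) : IsHarmonicLift E π (harmonicLift τ E p g) where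
  map_apply b := by
    rw [harmonicLift, LinearMap.comp_apply, LinearMap.comp_apply, map_cornerLift τ hp,
      coe_toCorner, map_mul, hp.map_eq_one, one_mul, hg]
  orthogonal c b hc := apply_cornerLift_eq_zero τ hp hS _ ((hp.2.2 c).mp hc)

theorem harmonicLift_apply_coe (hp : IsQuotientProjection π p) {g : B →ₗ[ℂ] A}
    (hg : ∀ b, π (g b) = b) (x : corner p) :
    harmonicLift τ E p g (π x) = cornerLift τ E p x := by
  rw [harmonicLift, LinearMap.comp_apply, LinearMap.comp_apply]
  congr 1
  ext
  rw [coe_toCorner, hp.mul_eq_mul_iff.mpr (hg _), mul_coe_corner hp.1.isIdempotentElem]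

end Projection

end

/-! ### Assembly of the quotient theorem. -/

theorem mainTheorem1
    {A : Type u} [CStarAlgebra A] [PartialOrder A] [StarOrderedRing A] [FiniteDimensional ℂ A]
    {B : Type w} [CStarAlgebra B] [PartialOrder B] [StarOrderedRing B] [Nontrivial B]
    (τ : FaithfulTrace A) (M : RiemannianMetric.{u, v} A)
    (hconn : M.IsMetricallyConnected) (hreal : IsRealForm (M.energyForm τ))
    (π : A →⋆ₐ[ℂ] B) (hπ : Function.Surjective π) :
    (∃! p : A, IsQuotientProjection π p) ∧
    ∀ p : A, IsQuotientProjection π p →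
      -- the block `S` of the Laplace operator on `(1-p)A` is invertible
      IsUnit (block (τ.laplacian (M.energyForm τ)) (1 - p) (1 - p) :
        Module.End ℂ (corner (1 - p))) ∧
      ∃ τB : FaithfulTrace B, (∀ b : corner p, τB.toFun (π b) = τ.toFun b) ∧
        ∃ MB : RiemannianMetric.{w, w} B,
          MB.IsMetricallyConnected ∧
          (∀ b b' : corner p,
            MB.energyForm τB (π b) (π b') = quotientForm τ (M.energyForm τ) p b b') ∧
          IsRealForm (MB.energyForm τB) ∧
          (∀ b : B, quotientSeminorm π (energyNorm (M.energyForm τ)) b =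
            energyNorm (MB.energyForm τB) b) ∧
          IsLeibniz (quotientSeminorm π (energyNorm (M.energyForm τ))) := by
  obtain ⟨p₀, hp₀⟩ := exists_isQuotientProjection τ π
  refine ⟨⟨p₀, hp₀, fun p hp => hp.eq_of_isQuotientProjection hp₀⟩, fun p hp => ?_⟩
  have hE := M.isCompletelyDirichlet_energyForm τ hreal
  have hker : ∀ a, M.energyForm τ a a = 0 → ∃ z : ℂ, a = z • (1 : A) := fun a ha =>
    hconn a (M.carreDuChamp_eq_zero_of_energyForm_eq_zero τ ha)
  -- Zero energy forces `c` to be a scalar, and `π 1 = 1 ≠ 0` because `B` is nonzero.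
  have hdef : ∀ c : A, π c = 0 → M.energyForm τ c c = 0 → c = 0 := fun c hc hcE => by
    obtain ⟨z, rfl⟩ := hker c hcE
    rw [map_smul, map_one, smul_eq_zero_iff_left one_ne_zero] at hc
    rw [hc, zero_smul]
  have hS : IsUnit (block (τ.laplacian (M.energyForm τ)) (1 - p) (1 - p) :
      Module.End ℂ (corner (1 - p))) :=
    isUnit_block_laplacian τ hp.1.one_sub fun c hc => hdef c <| by
      rw [← hc, map_mul, map_sub, map_one, hp.map_eq_one, sub_self, zero_mul]
  obtain ⟨g, hg'⟩ := π.toAlgHom.toLinearMap.exists_rightInverse_of_surjective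
    (LinearMap.range_eq_top.mpr hπ)
  have hg : ∀ b, π (g b) = b := fun b => LinearMap.congr_fun hg' b
  have : FiniteDimensional ℂ B := Module.Finite.of_surjective π.toAlgHom.toLinearMap hπ
  have hh := isHarmonicLift_harmonicLift (E := M.energyForm τ) τ hp hS hg
  have hF := hh.isCompletelyDirichlet_pullbackForm hE hdef hp
  let τB := τ.quotient hp hg
  have hMB := hF.energyForm_riemannianMetric τB
  have hquot := hh.quotientSeminorm_eq hE
  refine ⟨hS, τB, τ.quotient_apply hp hg, hF.riemannianMetric τB, fun b hb => ?_,
    fun b b' => ?_, ?_, fun b => ?_, ?_⟩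
  · have h0 := (hF.riemannianMetric τB).energyForm_eq_zero_of_carreDuChamp_eq_zero τB hb
    rw [hMB, pullbackForm_apply] at h0
    obtain ⟨z, hz⟩ := hker _ h0
    exact ⟨z, by rw [← hh.map_apply b, hz, map_smul, map_one]⟩
  -- The first argument may be replaced by `b` itself, which is a lift of `π b`.
  · rw [hMB, pullbackForm_apply, hh.apply_eq (b : A) _ _ rfl, harmonicLift_apply_coe τ hp hg,
      quotientForm_eq_apply_cornerLift τ hp]
  · rw [hMB]
    exact hF.real
  · rw [hMB, hquot]
  · have h := (hF.riemannianMetric τB).isLeibniz_energyNorm τB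
    rw [hMB] at h
    rwa [funext hquot]
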